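/- Let $\mathbb{T}=\mathbb{R}^2/\mathbb{Z}^2$ be the flat torus. For $\lambda\in\mathbb{R}$ let $N_{\mathbb{T}}(\lambda)$ be the number of eigenvalues of the Laplacian $-\Delta$ on $\mathbb{T}$, counted with multiplicity and including the eigenvalue $0$, that are strictly less than $\lambda$. For a Morse function $f$ on $\mathbb{T}$ and a critical point $p$ of $f$, let $W^s(p)$ (respectively $W^u(p)$) be the set of points whose trajectory under the flow of $-\nabla f$ converges to $p$ as $t\to+\infty$ (respectively $t\to-\infty$). A Neumann domain of $f$ is a connected component of a non-empty set $W^s(p)\cap W^u(q)$, where $p$ is a local minimum and $q$ a local maximum of $f$. For integers $m_x,m_y\ge 1$ let $f_{m_x,m_y}(x,y)=\sin(2\pi m_x x)\cos(2\pi m_y y)$, which is an eigenfunction on $\mathbb{T}$ with eigenvalue $\lambda_{m_x,m_y}=4\pi^2(m_x^2+m_y^2)$, and let $\mu_{m_x,m_y}$ be the number of its Neumann domains. Define $$F_\lambda(c)=\frac{4}{N_{\mathbb{T}}(\lambda)}\left|\left\{(m_x,m_y)\in\mathbb{N}_{\ge1}^2:\ \lambda_{m_x,m_y}<\lambda,\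 \frac{\mu_{m_x,m_y}}{N_{\mathbb{T}}(\lambda_{m_x,m_y})}<c\right\}\right| .$$ Then for every $0\le c<\frac4\pi$ $$\lim_{\lambda\to\infty}F_\lambda(c)=\frac{2}{\pi}\arcsin\left(\frac{\pi c}{4}\right)=\frac12\int_0^c\frac{dx}{\sqrt{1-\left(\frac{\pi}{4}x\right)^2}},$$ and for every $c\ge\frac4\pi$ $$\lim_{\lambda\to\infty}F_\lambda(c)=1.$$ -/

import Mathlib

noncomputable section

namespace NeumannTorus

open scoped Topology ContDiff InnerProductSpace Gradient
open Filter Laplacian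

/-- The Euclidean plane, the universal cover of the flat torus. -/
abbrev Plane : Type := EuclideanSpace ℝ (Fin 2)

/-- The flat torus `ℝ² / ℤ²`. -/
abbrev Torus : Type := UnitAddTorus (Fin 2)

/-- The covering map `ℝ² → ℝ² / ℤ²`. It is a local isometry, so the gradient and the Laplacian
of a function on the torus are those of its lift `F ∘ proj` to the plane. -/
def proj (x : Plane) : Torus := fun i => (x i : UnitAddCircle)

/-! ### The gradient flow and Neumann domains -/

/-- `γ` is a complete trajectory of the flow of `-∇ F` on the torus: it is the projection of a
curve in the plane that solves `γ̃' = -∇ (F ∘ proj)` for all times. -/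
def IsGradientTrajectory (F : Torus → ℝ) (γ : ℝ → Torus) : Prop :=
  ∃ g : ℝ → Plane, (∀ t, γ t = proj (g t)) ∧
    ∀ t, HasDerivAt g (-(∇ (fun x : Plane => F (proj x)) (g t))) t

/-- The stable manifold of `p`: the points that flow to `p` as `t → ∞`. -/
def stableManifold (F : Torus → ℝ) (p : Torus) : Set Torus :=
  {y | ∃ γ : ℝ → Torus, IsGradientTrajectory F γ ∧ γ 0 = y ∧ Tendsto γ atTop (𝓝 p)}

/-- The unstable manifold of `p`: the points that flow to `p` as `t → -∞`. -/
def unstableManifold (F : Torus → ℝ) (p : Torus) : Set Torus :=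
  {y | ∃ γ : ℝ → Torus, IsGradientTrajectory F γ ∧ γ 0 = y ∧ Tendsto γ atBot (𝓝 p)}

/-- A Neumann domain of a Morse function `F` is a connected component of a non-empty intersection
`W^s(p) ∩ W^u(q)`, where `p` is a minimum and `q` is a maximum of `F`. -/
def IsNeumannDomain (F : Torus → ℝ) (Ω : Set Torus) : Prop :=
  ∃ p q : Torus, IsLocalMin F p ∧ IsLocalMax F q ∧
    ∃ x ∈ stableManifold F p ∩ unstableManifold F q,
      Ω = connectedComponentIn (stableManifold F p ∩ unstableManifold F q) x

/-- The number of Neumann domains of `F`. -/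
def neumannCount (F : Torus → ℝ) : ℕ := {Ω : Set Torus | IsNeumannDomain F Ω}.ncard

/-! ### The spectrum of the torus -/

/-- The eigenspace of `-Δ` on the torus for the real number `μ`: all smooth complex functions `F`
with `-Δ F = μ F`. -/
def eigenspace (μ : ℝ) : Submodule ℂ (Torus → ℂ) where
  carrier := {F | ContDiff ℝ ∞ (fun x : Plane => F (proj x)) ∧
    ∀ x : Plane, -(Δ (fun y : Plane => F (proj y)) x) = (μ : ℂ) * F (proj x)}
  zero_mem' := by
    refine ⟨contDiff_const, fun x => ?_⟩
    have h := InnerProductSpace.laplacian_const (E := Plane) (c := (0 : ℂ))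
    simp [h]
  add_mem' := by
    rintro F G ⟨hF, hF'⟩ ⟨hG, hG'⟩
    refine ⟨hF.add hG, fun x => ?_⟩
    have h2 : (2 : WithTop ℕ∞) ≤ ∞ := WithTop.coe_le_coe.2 le_top
    have h := (hF.of_le h2).contDiffAt.laplacian_add (x := x) (hG.of_le h2).contDiffAt
    have e : (fun y : Plane => (F + G) (proj y)) =
        (fun y : Plane => F (proj y)) + (fun y : Plane => G (proj y)) := rfl
    rw [e, h, neg_add, hF', hG', Pi.add_apply, mul_add]
  smul_mem' := by
    rintro a F ⟨hF, hF'⟩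
    refine ⟨hF.const_smul a, fun x => ?_⟩
    have h2 : (2 : WithTop ℕ∞) ≤ ∞ := WithTop.coe_le_coe.2 le_top
    have h := InnerProductSpace.laplacian_smul a ((hF.of_le h2).contDiffAt (x := x))
    have e : (fun y : Plane => (a • F) (proj y)) = a • (fun y : Plane => F (proj y)) := rfl
    rw [e, h, ← smul_neg, hF', Pi.smul_apply, smul_eq_mul, smul_eq_mul]
    ring

/-- The spectral position `N(E)` in the torus: the number of eigenvalues of `-Δ`, counted with
multiplicity and including the eigenvalue `0`, that are less than `E`. -/
def spectralPosition (E : ℝ) : ℕ :=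
  ∑ᶠ (μ : ℝ) (_ : μ < E), Module.finrank ℂ (eigenspace μ)

/-! ### Separable eigenfunctions and the distribution of their Neumann counts -/

theorem sin_periodic (m : ℕ) :
    Function.Periodic (fun x : ℝ => Real.sin (2 * Real.pi * m * x)) 1 := by
  intro x
  have h : 2 * Real.pi * m * (x + 1) = 2 * Real.pi * m * x + m * (2 * Real.pi) := by ring
  simp only [h, Real.sin_add_nat_mul_two_pi]

theorem cos_periodic (m : ℕ) :
    Function.Periodic (fun x : ℝ => Real.cos (2 * Real.pi * m * x)) 1 := by
  intro x
  have h : 2 * Real.pi * m * (x + 1) = 2 * Real.pi * m * x + m * (2 * Real.pi) := by ring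
  simp only [h, Real.cos_add_nat_mul_two_pi]

/-- The function `(x, y) ↦ sin (2 π m x) cos (2 π n y)` on the torus. -/
def separable (m n : ℕ) : Torus → ℝ :=
  fun z => (sin_periodic m).lift (z 0) * (cos_periodic n).lift (z 1)

theorem separable_proj (m n : ℕ) (x : Plane) :
    separable m n (proj x) =
      Real.sin (2 * Real.pi * m * x 0) * Real.cos (2 * Real.pi * n * x 1) := rfl

/-- The eigenvalue `4 π² (m² + n²)` of `separable m n`. -/
def eigenvalue (m n : ℕ) : ℝ := 4 * Real.pi ^ 2 * ((m : ℝ) ^ 2 + (n : ℝ) ^ 2)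

/-- The cumulative distribution function `F_E(c)` of the normalized Neumann counts of the separable
eigenfunctions with eigenvalue less than `E`. The factor `4` accounts for the four products of
sines and cosines with the same `(m, n)`, which are translates of each other. -/
def cdf (E c : ℝ) : ℝ :=
  4 / (spectralPosition E : ℝ) *
    ({k : ℕ × ℕ | 0 < k.1 ∧ 0 < k.2 ∧ eigenvalue k.1 k.2 < E ∧
      (neumannCount (separable k.1 k.2) : ℝ) / (spectralPosition (eigenvalue k.1 k.2) : ℝ) < c}.ncard
        : ℝ)

end NeumannTorus

end

/-! Put u = 2πm·x and v = 2πn·y. The flow of -∇(sin u cos v) has weights A = (2πm)² and B = (2πn)²,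
and A·n² = B·m². Hence it multiplies cos(u)^(n²) and sin(v)^(m²) by the same positive factor
(`IsFlow.exists_pos_cos_pow_sin_pow`), so the sign of |cos u|^(n²) - |sin v|^(m²) is constant along
trajectories.

Where this sign is negative, neither sin u nor sin v can vanish. The trajectory is therefore trapped
in one square of side π, moves monotonically in v, and joins the two extrema on the vertical midline
of the square. Where it is positive, exchanging the coordinates reduces to the previous case. Where
the difference is zero, a trajectory reaching the level f = 0 would be at a saddle, hence constant;
so no such trajectory joins a maximum to a minimum. The Neumann domains are thus exactly the open
connected cells cut out of the squares, 4mn of each kind, and their number is 8mn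
(`neumannCount_separable`).

On the spectral side, the eigenspaces are spanned by characters (`finrank_eigenspace`), so N(E)
counts lattice points in a disc and N(E) ~ E/(4π) (`tendsto_spectralPosition_div`). At E =
4π²(m²+n²) the normalized count is therefore close to 8mn/(π(m²+n²)) = (4/π) sin 2θ, with θ the
polar angle of (m, n). Asking that it be less than c selects a part of the quarter disc of area
arcsin(πc/4)/2 (`volume_sector`), and counting lattice points there gives the limit (2/π)
arcsin(πc/4). The error in the Weyl law is absorbed by moving c slightly and discarding finitely
many frequencies; continuity of arcsin closes the gap (`tendsto_cdf`). For c ≥ 4/π the arcsine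
saturates at π/2. -/

namespace NeumannTorus

open Real Filter Set
open scoped Topology NNReal

/-! ### The gradient flow of `sin u * cos v` for a constant diagonal metric -/

/-- `(u, v)` solves the gradient flow equations of `-(sin u * cos v)` with weights `A`, `B`. -/
structure IsFlow (A B : ℝ) (u v : ℝ → ℝ) : Prop where
  left : ∀ t, HasDerivAt u (-(A * (cos (u t) * cos (v t)))) t
  right : ∀ t, HasDerivAt v (B * (sin (u t) * sin (v t))) t

namespace IsFlow

variable {A B : ℝ} {u v : ℝ → ℝ}

theorem continuous_left (h : IsFlow A B u v) : Continuous u :=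
  continuous_iff_continuousAt.2 fun t => (h.left t).continuousAt

theorem continuous_right (h : IsFlow A B u v) : Continuous v :=
  continuous_iff_continuousAt.2 fun t => (h.right t).continuousAt

/-- Time reversal, combined with the reflection of `v`. -/
theorem reverse_right (h : IsFlow A B u v) :
    IsFlow A B (fun t => u (-t)) (fun t => π - v (-t)) where
  left t := by
    convert! (h.left (-t)).scomp t (hasDerivAt_neg t) using 1
    simp
  right t := by
    convert! ((h.right (-t)).scomp t (hasDerivAt_neg t)).const_sub π using 1
    simp

/-- Time reversal, combined with a half-period shift of `u`. -/
theorem reverse_left (h : IsFlow A B u v) :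
    IsFlow A B (fun t => u (-t) + π) (fun t => v (-t)) where
  left t := by
    convert! ((h.left (-t)).scomp t (hasDerivAt_neg t)).add_const π using 1
    simp
  right t := by
    convert! (h.right (-t)).scomp t (hasDerivAt_neg t) using 1
    simp

/-- The exchange of the two coordinates. -/
theorem swap (h : IsFlow A B u v) :
    IsFlow B A (fun t => v t + π / 2) (fun t => u t - π / 2) where
  left t := by
    convert! (h.right t).add_const (π / 2) using 1
    rw [cos_add_pi_div_two, cos_sub_pi_div_two]; ring
  right t := by
    convert! (h.left t).sub_const (π / 2) using 1
    rw [sin_add_pi_div_two, sin_sub_pi_div_two]; ring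

/-- Translation by a pair of multiples of `π`. -/
theorem sub_int_mul_pi (h : IsFlow A B u v) {j k : ℤ} (hjk : Even (j + k)) :
    IsFlow A B (fun t => u t - j * π) (fun t => v t - k * π) where
  left t := by
    convert! (h.left t).sub_const (j * π) using 1
    rw [cos_sub_int_mul_pi, cos_sub_int_mul_pi]
    have : ((-1 : ℝ) ^ j) * (-1) ^ k = 1 := by
      rw [← zpow_add₀ (by norm_num)]; exact hjk.neg_one_zpow
    linear_combination (-A * cos (u t) * cos (v t)) * this
  right t := by
    convert! (h.right t).sub_const (k * π) using 1
    rw [sin_sub_int_mul_pi, sin_sub_int_mul_pi]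
    have : ((-1 : ℝ) ^ j) * (-1) ^ k = 1 := by
      rw [← zpow_add₀ (by norm_num)]; exact hjk.neg_one_zpow
    linear_combination (B * sin (u t) * sin (v t)) * this

end IsFlow

/-- Solutions of a scalar linear differential equation are multiples of an exponential. -/
theorem eq_mul_exp_of_hasDerivAt {κ y : ℝ → ℝ} (hκ : Continuous κ)
    (hy : ∀ t, HasDerivAt y (κ t * y t) t) (t : ℝ) :
    y t = y 0 * exp (∫ s in (0 : ℝ)..t, κ s) := by
  have hK : ∀ t, HasDerivAt (fun t => ∫ s in (0 : ℝ)..t, κ s) (κ t) t := fun t =>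
    hκ.integral_hasStrictDerivAt 0 t |>.hasDerivAt
  have h : ∀ t, HasDerivAt (fun t => y t * exp (-∫ s in (0 : ℝ)..t, κ s)) 0 t := fun t => by
    convert! (hy t).mul (hK t).fun_neg.exp using 1
    ring
  have hc := is_const_of_deriv_eq_zero (fun t => (h t).differentiableAt)
    (fun t => (h t).deriv) t 0
  simp only [intervalIntegral.integral_same, neg_zero, exp_zero, mul_one] at hc
  rw [← hc, mul_assoc, ← exp_add]
  simp

namespace IsFlow

variable {A B : ℝ} {u v : ℝ → ℝ} {N M : ℕ}

/-- The balance A·N = B·M makes both powers solve the same linear equation y' = κ(t)·y with κ =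
A·N·sin u·cos v. The common factor E is the exponential of the integral of κ; it replaces a
conserved quotient and needs no division. -/
theorem exists_pos_cos_pow_sin_pow (h : IsFlow A B u v) (hAB : A * N = B * M) (t : ℝ) :
    ∃ E : ℝ, 0 < E ∧ cos (u t) ^ N = cos (u 0) ^ N * E ∧ sin (v t) ^ M = sin (v 0) ^ M * E := by
  have hu := h.continuous_left
  have hv := h.continuous_right
  have hκ : Continuous fun t => A * N * (sin (u t) * cos (v t)) := by fun_prop
  -- The case k = 0 is separate because k - 1 is truncated there; the factor k then kills both
  -- sides.
  have pow_deriv : ∀ (k : ℕ) (x : ℝ), (k : ℝ) * x ^ (k - 1) * x = k * x ^ k := by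
    intro k x
    rcases k with _ | k
    · simp
    · rw [mul_assoc, Nat.add_sub_cancel, pow_succ]
  refine ⟨_, exp_pos _, eq_mul_exp_of_hasDerivAt (y := fun t => cos (u t) ^ N) hκ ?_ t,
    eq_mul_exp_of_hasDerivAt (y := fun t => sin (v t) ^ M) hκ ?_ t⟩
  · intro t
    convert! ((h.left t).cos).pow N using 1
    linear_combination (-A * sin (u t) * cos (v t)) * pow_deriv N (cos (u t))
  · intro t
    convert! ((h.right t).sin).pow M using 1
    rw [hAB]
    linear_combination (-B * sin (u t) * cos (v t)) * pow_deriv M (sin (v t))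

end IsFlow

theorem mem_Ioo_of_sin_ne_zero {w : ℝ → ℝ} (hw : Continuous w) (hs : ∀ t, sin (w t) ≠ 0)
    (h0 : w 0 ∈ Ioo 0 π) (t : ℝ) : w t ∈ Ioo 0 π := by
  constructor
  · by_contra! h
    obtain ⟨s, hs'⟩ := mem_range_of_exists_le_of_exists_ge hw ⟨t, h⟩ ⟨0, h0.1.le⟩
    exact hs s (by rw [hs', sin_zero])
  · by_contra! h
    obtain ⟨s, hs'⟩ := mem_range_of_exists_le_of_exists_ge hw ⟨0, h0.2.le⟩ ⟨t, h⟩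
    exact hs s (by rw [hs', sin_pi])

theorem sin_ne_zero_of_abs_cos_pow_lt {N : ℕ} {x y : ℝ} (hy : |y| ≤ 1)
    (h : |cos x ^ N| < |y|) : sin x ≠ 0 := by
  intro hx
  have : |cos x| = 1 := by
    have := sin_sq_add_cos_sq x
    rw [hx] at this
    rw [← sq_eq_sq₀ (abs_nonneg _) zero_le_one, sq_abs]; linarith
  rw [abs_pow, this, one_pow] at h
  linarith

theorem abs_sin_pow_le_one (x : ℝ) (M : ℕ) : |sin x ^ M| ≤ 1 := by
  rw [abs_pow]; exact pow_le_one₀ (abs_nonneg _) (abs_sin_le_one _)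

theorem sin_ne_zero_of_abs_lt_abs_sin_pow {M : ℕ} (hM : 0 < M) {x y : ℝ}
    (h : |y| < |sin x ^ M|) : sin x ≠ 0 := by
  intro hx
  rw [hx, zero_pow hM.ne', abs_zero] at h
  exact absurd h (not_lt.2 (abs_nonneg _))

namespace IsFlow

variable {A B : ℝ} {u v : ℝ → ℝ} {N M : ℕ}

section cell

variable (h : IsFlow A B u v) (hAB : A * N = B * M) (hN : 0 < N) (hM : 0 < M) (hB : 0 < B)
  (hu : u 0 ∈ Ioo 0 π) (hv : v 0 ∈ Ioo 0 π) (h0 : |cos (u 0) ^ N| < |sin (v 0) ^ M|)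

include h hAB h0 in
theorem abs_cos_pow_lt (t : ℝ) : |cos (u t) ^ N| < |sin (v t) ^ M| := by
  obtain ⟨E, hE, h1, h2⟩ := h.exists_pos_cos_pow_sin_pow hAB t
  rw [h1, h2, abs_mul, abs_mul]
  exact mul_lt_mul_of_pos_right h0 (abs_pos.2 hE.ne')

include h hAB hu h0 in
theorem left_mem (t : ℝ) : u t ∈ Ioo 0 π :=
  mem_Ioo_of_sin_ne_zero h.continuous_left
    (fun t => sin_ne_zero_of_abs_cos_pow_lt (abs_sin_pow_le_one _ _) (h.abs_cos_pow_lt hAB h0 t))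
    hu t

include h hAB hM hv h0 in
theorem right_mem (t : ℝ) : v t ∈ Ioo 0 π :=
  mem_Ioo_of_sin_ne_zero h.continuous_right
    (fun t => sin_ne_zero_of_abs_lt_abs_sin_pow hM (h.abs_cos_pow_lt hAB h0 t)) hv t

-- Since Q·E = |sin v|^M ≤ 1, the common factor gives |cos u|^N ≤ P/Q < 1 at all times. Bernoulli's
-- inequality turns this into a lower bound for 1 - |cos u|, and sin u ≥ sin² u ≥ 1 - |cos u|. This
-- uniform bound keeps the speed of v from degenerating as u varies.
include h hAB hN hu h0 in
theorem exists_le_sin : ∃ δ > 0, ∀ t, δ ≤ sin (u t) := by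
  set P := |cos (u 0) ^ N|
  set Q := |sin (v 0) ^ M|
  have hQ : 0 < Q := (abs_nonneg _).trans_lt h0
  have hN' : (0 : ℝ) < N := Nat.cast_pos.2 hN
  refine ⟨(1 - P / Q) / N, div_pos (sub_pos.2 ((div_lt_one hQ).2 h0)) hN', fun t => ?_⟩
  obtain ⟨E, hE, h1, h2⟩ := h.exists_pos_cos_pow_sin_pow hAB t
  have h3 : |cos (u t)| ^ N ≤ P / Q := by
    rw [← abs_pow, h1, abs_mul, le_div_iff₀ hQ]
    have := abs_sin_pow_le_one (v t) M
    rw [h2, abs_mul] at this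
    calc P * |E| * Q = P * (Q * |E|) := by ring
      _ ≤ P := mul_le_of_le_one_right (abs_nonneg _) this
  have h4 := one_add_mul_le_pow (a := |cos (u t)| - 1) (by linarith [abs_nonneg (cos (u t))]) N
  rw [add_sub_cancel] at h4
  have h5 : (1 - P / Q) / N ≤ 1 - |cos (u t)| := by
    rw [div_le_iff₀ hN']; linarith
  have hs := sin_pos_of_mem_Ioo (h.left_mem hAB hu h0 t)
  have h6 := sin_sq_add_cos_sq (u t)
  rw [← sq_abs (cos _)] at h6
  have h7 : |cos (u t)| ≤ 1 := abs_cos_le_one _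
  nlinarith [abs_nonneg (cos (u t)), sin_le_one (u t)]

include h hAB hN hM hB hu hv h0 in
theorem tendsto_right_atTop : Tendsto v atTop (𝓝 π) := by
  obtain ⟨δ, hδ, hle⟩ := h.exists_le_sin hAB hN hu h0
  have hmem := h.right_mem hAB hM hv h0
  have hmono : Monotone v := monotone_of_hasDerivAt_nonneg h.right fun t =>
    mul_nonneg hB.le (mul_nonneg (hδ.le.trans (hle t)) (sin_pos_of_mem_Ioo (hmem t)).le)
  refine tendsto_order.2 ⟨fun c hc => ?_, fun c hc => .of_forall fun t => (hmem t).2.trans hc⟩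
  obtain ⟨t, ht⟩ : ∃ t, c < v t := by
    by_contra! hle'
    have hc0 : 0 < c := (hmem 0).1.trans_le (hle' 0)
    set s := min (sin (v 0)) (sin c)
    have hs : 0 < s := lt_min (sin_pos_of_mem_Ioo hv) (sin_pos_of_mem_Ioo ⟨hc0, hc⟩)
    -- If v stayed in [v 0, c] with c < π, concavity of sine would bound sin v below by its values
    -- at the two endpoints, so v would move at least at a fixed positive speed.
    have hder : ∀ t ∈ interior (Ici (0 : ℝ)), B * (δ * s) ≤ deriv v t := fun t ht => by
      rw [interior_Ici] at ht
      rw [(h.right t).deriv]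
      have h1 : s ≤ sin (v t) := by
        refine strictConcaveOn_sin_Icc.concaveOn.min_le_of_mem_Icc (Ioo_subset_Icc_self hv)
          ⟨hc0.le, hc.le⟩ ⟨hmono (le_of_lt ht), hle' t⟩
      have := hle t
      have := hδ.le.trans this
      gcongr
    have hk : 0 < B * (δ * s) := by positivity
    -- In time T the minimal speed covers a distance c, which carries v from v 0 > 0 beyond c.
    set T := c / (B * (δ * s))
    have hT : 0 ≤ T := by positivity
    have h1 := (convex_Ici (0 : ℝ)).mul_sub_le_image_sub_of_le_deriv
      h.continuous_right.continuousOn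
      (fun t _ => (h.right t).differentiableAt.differentiableWithinAt) hder 0 self_mem_Ici T hT hT
    have h2 : B * (δ * s) * (T - 0) = c := by rw [sub_zero]; exact mul_div_cancel₀ _ hk.ne'
    have := hle' T
    linarith [hv.1]
  filter_upwards [eventually_ge_atTop t] with s hs using ht.trans_le (hmono hs)

/-- The cell pinches at its two tips: |cos u|^N is squeezed below |sin v|^M, and arccos recovers u
because u stays in (0, π). -/
theorem tendsto_pi_div_two_of_abs_cos_pow_lt {l : Filter ℝ} (hN : 0 < N) (hM : 0 < M)
    (hu : ∀ t, u t ∈ Ioo 0 π) (hlt : ∀ t, |cos (u t) ^ N| < |sin (v t) ^ M|)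
    (hv : Tendsto (fun t => sin (v t)) l (𝓝 0)) : Tendsto u l (𝓝 (π / 2)) := by
  have h1 : Tendsto (fun t => |sin (v t) ^ M|) l (𝓝 0) := by
    have := (hv.pow M).abs
    rwa [zero_pow hM.ne', abs_zero] at this
  have h2 : Tendsto (fun t => |cos (u t)| ^ N) l (𝓝 0) :=
    squeeze_zero (fun t => by positivity) (fun t => by rw [← abs_pow]; exact (hlt t).le) h1
  have h3 : Tendsto (fun t => cos (u t)) l (𝓝 0) := by
    rw [tendsto_zero_iff_abs_tendsto_zero]
    have hpow : Tendsto (fun t => (|cos (u t)| ^ N) ^ ((N : ℝ)⁻¹)) l (𝓝 0) := by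
      have := h2.rpow_const (p := (N : ℝ)⁻¹) (Or.inr (by positivity))
      rwa [zero_rpow (by positivity)] at this
    refine hpow.congr fun t => ?_
    exact pow_rpow_inv_natCast (abs_nonneg _) hN.ne'
  have h4 := (continuous_arccos.tendsto 0).comp h3
  rw [arccos_zero] at h4
  exact h4.congr fun t => arccos_cos (hu t).1.le (hu t).2.le

include h hAB hN hM hB hu hv h0 in
theorem tendsto_atTop : Tendsto u atTop (𝓝 (π / 2)) ∧ Tendsto v atTop (𝓝 π) := by
  have hv' := h.tendsto_right_atTop hAB hN hM hB hu hv h0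
  refine ⟨tendsto_pi_div_two_of_abs_cos_pow_lt hN hM (h.left_mem hAB hu h0)
    (h.abs_cos_pow_lt hAB h0) ?_, hv'⟩
  simpa [Function.comp_def] using (continuous_sin.tendsto π).comp hv'

include h hAB hN hM hB hu hv h0 in
theorem tendsto_atBot : Tendsto u atBot (𝓝 (π / 2)) ∧ Tendsto v atBot (𝓝 0) := by
  obtain ⟨h1, h2⟩ := h.reverse_right.tendsto_atTop hAB hN hM hB (by simpa using hu)
    (by simpa using hv.symm) (by simpa using h0)
  refine ⟨by simpa [Function.comp_def] using h1.comp tendsto_neg_atBot_atTop, ?_⟩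
  simpa [Function.comp_def] using (h2.comp tendsto_neg_atBot_atTop).const_sub π

end cell

end IsFlow

/-- The cell of the points of the `(j, k)`-th square that flow to the vertical midline. -/
def squareCell (N M : ℕ) (j k : ℤ) : Set (ℝ × ℝ) :=
  {p | p.1 - j * π ∈ Ioo 0 π ∧ p.2 - k * π ∈ Ioo 0 π ∧ |cos p.1 ^ N| < |sin p.2 ^ M|}

theorem abs_neg_one_zpow (j : ℤ) : |(-1 : ℝ) ^ j| = 1 := by rw [abs_zpow]; simp

theorem abs_cos_sub_int_mul_pi_pow (x : ℝ) (j : ℤ) (N : ℕ) :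
    |cos (x - j * π) ^ N| = |cos x ^ N| := by
  rw [cos_sub_int_mul_pi, abs_pow, abs_mul, abs_neg_one_zpow, one_mul, abs_pow]

theorem abs_sin_sub_int_mul_pi_pow (x : ℝ) (j : ℤ) (N : ℕ) :
    |sin (x - j * π) ^ N| = |sin x ^ N| := by
  rw [sin_sub_int_mul_pi, abs_pow, abs_mul, abs_neg_one_zpow, one_mul, abs_pow]

theorem tendsto_of_tendsto_sub {w : ℝ → ℝ} {l : Filter ℝ} {a b : ℝ}
    (h : Tendsto (fun t => w t - a) l (𝓝 b)) : Tendsto w l (𝓝 (b + a)) := by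
  simpa using h.add_const a

/-- Translation by (jπ, kπ) with j + k even preserves the flow, which reduces the claim to the
square at the origin. -/
theorem exists_limits_of_even {A B : ℝ} {N M : ℕ} (hAB : A * N = B * M) (hN : 0 < N) (hM : 0 < M)
    (hB : 0 < B) {j k : ℤ} (hjk : Even (j + k)) {u v : ℝ → ℝ} (h : IsFlow A B u v)
    (h0 : (u 0, v 0) ∈ squareCell N M j k) :
    (Tendsto u atTop (𝓝 (π / 2 + j * π)) ∧ Tendsto v atTop (𝓝 (π + k * π))) ∧
      Tendsto u atBot (𝓝 (π / 2 + j * π)) ∧ Tendsto v atBot (𝓝 (0 + k * π)) := by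
  obtain ⟨h1, h2, h3⟩ := h0
  have h' := h.sub_int_mul_pi hjk
  rw [← abs_cos_sub_int_mul_pi_pow _ j, ← abs_sin_sub_int_mul_pi_pow _ k] at h3
  obtain ⟨h4, h5⟩ := h'.tendsto_atTop hAB hN hM hB h1 h2 h3
  obtain ⟨h6, h7⟩ := h'.tendsto_atBot hAB hN hM hB h1 h2 h3
  exact ⟨⟨tendsto_of_tendsto_sub h4, tendsto_of_tendsto_sub h5⟩, tendsto_of_tendsto_sub h6,
    tendsto_of_tendsto_sub h7⟩

/-- All flow lines through a cell run from the same maximum to the same minimum. -/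
theorem exists_limits_squareCell {A B : ℝ} {N M : ℕ} (hAB : A * N = B * M) (hN : 0 < N)
    (hM : 0 < M) (hB : 0 < B) (j k : ℤ) :
    ∃ p q : ℝ × ℝ, sin p.1 * cos p.2 = -1 ∧ sin q.1 * cos q.2 = 1 ∧
      ∀ u v : ℝ → ℝ, IsFlow A B u v → (u 0, v 0) ∈ squareCell N M j k →
        (Tendsto u atTop (𝓝 p.1) ∧ Tendsto v atTop (𝓝 p.2)) ∧
        Tendsto u atBot (𝓝 q.1) ∧ Tendsto v atBot (𝓝 q.2) := by
  have hpow : ∀ j k : ℤ, (-1 : ℝ) ^ j * (-1) ^ k = (-1) ^ (j + k) := fun j k =>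
    (zpow_add₀ (by norm_num) _ _).symm
  rcases Int.even_or_odd (j + k) with hjk | hjk
  · refine ⟨(π / 2 + j * π, π + k * π), (π / 2 + j * π, 0 + k * π), ?_, ?_,
      fun u v h h0 => exists_limits_of_even hAB hN hM hB hjk h h0⟩
    · simp only [sin_add_int_mul_pi, cos_add_int_mul_pi, sin_pi_div_two, cos_pi]
      have := hpow j k
      rw [hjk.neg_one_zpow] at this
      linear_combination -this
    · simp only [sin_add_int_mul_pi, cos_add_int_mul_pi, sin_pi_div_two, cos_zero]
      have := hpow j k
      rw [hjk.neg_one_zpow] at this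
      linear_combination this
  · refine ⟨(π / 2 + j * π, 0 + k * π), (π / 2 + j * π, π + k * π), ?_, ?_,
      fun u v h h0 => ?_⟩
    · simp only [sin_add_int_mul_pi, cos_add_int_mul_pi, sin_pi_div_two, cos_zero]
      have := hpow j k
      rw [hjk.neg_one_zpow] at this
      linear_combination this
    · simp only [sin_add_int_mul_pi, cos_add_int_mul_pi, sin_pi_div_two, cos_pi]
      have := hpow j k
      rw [hjk.neg_one_zpow] at this
      linear_combination -this
    -- For odd j + k, reversing time and shifting u by π gives a flow in a square of even parity;
    -- the two ends of the trajectory are exchanged.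
    · have hjk' : Even (j + 1 + k) := by
        rw [add_right_comm]; exact hjk.add_one
      have h0' : ((fun t => u (-t) + π) 0, (fun t => v (-t)) 0) ∈ squareCell N M (j + 1) k := by
        obtain ⟨h1, h2, h3⟩ := h0
        refine ⟨?_, by simpa using h2, ?_⟩
        · convert h1 using 1; simp; ring
        · simpa [abs_pow] using h3
      obtain ⟨⟨h1, h2⟩, h3, h4⟩ := exists_limits_of_even hAB hN hM hB hjk' h.reverse_left h0'
      have key : ∀ {l l' : Filter ℝ} {c : ℝ}, Tendsto Neg.neg l' l →
          Tendsto (fun t => u (-t) + π) l (𝓝 (c + ((j + 1 : ℤ) : ℝ) * π)) →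
          Tendsto u l' (𝓝 (c + j * π)) := by
        intro l l' c hl hu
        have := (hu.comp hl).sub_const π
        simp only [Function.comp_def, neg_neg, add_sub_cancel_right] at this
        convert! this using 2
        push_cast; ring
      refine ⟨⟨key tendsto_neg_atTop_atBot h3, ?_⟩, key tendsto_neg_atBot_atTop h1, ?_⟩
      · simpa [Function.comp_def] using h4.comp tendsto_neg_atTop_atBot
      · simpa [Function.comp_def] using h2.comp tendsto_neg_atBot_atTop

end NeumannTorus

/-! ### Complete integral curves, separatrices and lifted trajectories -/

namespace NeumannTorus

open Real Filter Set
open scoped Topology NNReal Gradient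

/-! ### Global solutions of autonomous differential equations -/

/-- A bounded Lipschitz vector field has global integral curves. -/
theorem exists_forall_hasDerivAt_of_lipschitzWith {E : Type*} [NormedAddCommGroup E]
    [NormedSpace ℝ E] [CompleteSpace E] {f : E → E} {K L : ℝ≥0} (hf : LipschitzWith K f)
    (hL : ∀ x, ‖f x‖ ≤ L) (x₀ : E) :
    ∃ γ : ℝ → E, γ 0 = x₀ ∧ ∀ t, HasDerivAt γ (f (γ t)) t := by
  have local_sol : ∀ n : ℕ, ∃ γ : ℝ → E, γ 0 = x₀ ∧
      ∀ t ∈ Ioo (-(n + 1) : ℝ) (n + 1), HasDerivAt γ (f (γ t)) t := by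
    intro n
    have hn : (0 : ℝ) ≤ n + 1 := by positivity
    -- On the time interval [-(n+1), n+1] a field bounded by L cannot leave the ball of radius
    -- L(n+1), so Picard–Lindelöf applies on the whole interval. The radius 0 fixes the initial
    -- point.
    have hpl : IsPicardLindelof (fun _ => f) (tmin := -(n + 1)) (tmax := n + 1)
        ⟨0, neg_nonpos.2 hn, hn⟩ x₀ (L * (n + 1)) 0 L K :=
      .of_time_independent (fun x _ => hL x) hf.lipschitzOnWith (by simp)
    obtain ⟨γ, h0, h⟩ := hpl.exists_eq_forall_mem_Icc_hasDerivWithinAt₀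
    exact ⟨γ, h0, fun t ht => (h t (Ioo_subset_Icc_self ht)).hasDerivAt (Icc_mem_nhds ht.1 ht.2)⟩
  choose γ h0 hγ using local_sol
  have agree : ∀ {n k : ℕ}, n ≤ k → EqOn (γ n) (γ k) (Ioo (-(n + 1) : ℝ) (n + 1)) := by
    intro n k hnk
    have hnk' : (n : ℝ) ≤ k := Nat.cast_le.2 hnk
    refine ODE_solution_unique_of_mem_Ioo (v := fun _ => f) (s := fun _ => univ) (t₀ := 0)
      (fun t _ => hf.lipschitzOnWith) ⟨by linarith [Nat.cast_nonneg (α := ℝ) n], by positivity⟩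
      (fun t ht => ⟨hγ n t ht, mem_univ _⟩) (fun t ht => ⟨hγ k t ?_, mem_univ _⟩)
      ((h0 n).trans (h0 k).symm)
    exact ⟨by linarith [ht.1], by linarith [ht.2]⟩
  -- The solution of index ⌈|t|⌉ is defined on an open interval around t, and `agree` makes the
  -- choice of index immaterial.
  refine ⟨fun t => γ ⌈|t|⌉₊ t, by simpa using h0 _, fun t => ?_⟩
  set k := ⌈|t|⌉₊ + 1
  have hk : |t| < k := by
    have := Nat.le_ceil |t|
    push_cast [k]; linarith
  have ht : t ∈ Ioo (-(k : ℝ)) k := abs_lt.1 hk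
  have hmem : ∀ s ∈ Ioo (-(k : ℝ)) k, γ ⌈|s|⌉₊ s = γ k s := by
    intro s hs
    refine agree (Nat.ceil_le.2 (abs_lt.2 hs).le) ?_
    have := Nat.le_ceil |s|
    exact abs_lt.1 (by linarith)
  beta_reduce
  rw [hmem t ht]
  refine (hγ k t ⟨by linarith [ht.1], by linarith [ht.2]⟩).congr_of_eventuallyEq ?_
  filter_upwards [Ioo_mem_nhds ht.1 ht.2] with s hs using hmem s hs

/-! ### Existence and uniqueness of flow lines -/

/-- The vector field of `IsFlow`. -/
noncomputable def flowField (A B : ℝ) (p : ℝ × ℝ) : ℝ × ℝ :=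
  (-(A * (cos p.1 * cos p.2)), B * (sin p.1 * sin p.2))

theorem isFlow_iff {A B : ℝ} {γ : ℝ → ℝ × ℝ} :
    IsFlow A B (fun t => (γ t).1) (fun t => (γ t).2) ↔
      ∀ t, HasDerivAt γ (flowField A B (γ t)) t := by
  refine ⟨fun h t => (h.left t).prodMk (h.right t), fun h => ⟨fun t => ?_, fun t => ?_⟩⟩
  · exact (hasFDerivAt_fst (p := γ t)).comp_hasDerivAt t (h t)
  · exact (hasFDerivAt_snd (p := γ t)).comp_hasDerivAt t (h t)

theorem abs_mul_sub_mul_le {a b a' b' x y : ℝ} (ha : |a - a'| ≤ x) (hb : |b - b'| ≤ y)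
    (h1 : |a'| ≤ 1) (h2 : |b| ≤ 1) : |a * b - a' * b'| ≤ x + y := by
  have hx : 0 ≤ x := (abs_nonneg _).trans ha
  calc |a * b - a' * b'| = |(a - a') * b + a' * (b - b')| := by congr 1; ring
    _ ≤ |a - a'| * |b| + |a'| * |b - b'| := by
      rw [← abs_mul, ← abs_mul]; exact abs_add_le _ _
    _ ≤ x * 1 + 1 * y := by gcongr
    _ = x + y := by ring

theorem lipschitzWith_flowField (A B : ℝ) :
    LipschitzWith (2 * (‖A‖₊ + ‖B‖₊)) (flowField A B) := by
  refine LipschitzWith.of_dist_le_mul fun p q => ?_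
  have h1 : |p.1 - q.1| ≤ dist p q := le_max_left _ _
  have h2 : |p.2 - q.2| ≤ dist p q := le_max_right _ _
  have hc := abs_mul_sub_mul_le ((abs_cos_sub_cos_le p.1 q.1).trans h1)
    ((abs_cos_sub_cos_le p.2 q.2).trans h2) (abs_cos_le_one _) (abs_cos_le_one _)
  have hs := abs_mul_sub_mul_le ((abs_sin_sub_sin_le p.1 q.1).trans h1)
    ((abs_sin_sub_sin_le p.2 q.2).trans h2) (abs_sin_le_one _) (abs_sin_le_one _)
  have hd : 0 ≤ dist p q := dist_nonneg
  push_cast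
  rw [norm_eq_abs, norm_eq_abs]
  refine max_le ?_ ?_
  · change |-(A * (cos p.1 * cos p.2)) - -(A * (cos q.1 * cos q.2))| ≤ _
    rw [neg_sub_neg, ← mul_sub, abs_mul, abs_sub_comm]
    nlinarith [abs_nonneg A, abs_nonneg B, mul_nonneg (abs_nonneg B) hd]
  · change |B * (sin p.1 * sin p.2) - B * (sin q.1 * sin q.2)| ≤ _
    rw [← mul_sub, abs_mul]
    nlinarith [abs_nonneg A, abs_nonneg B, mul_nonneg (abs_nonneg A) hd]

theorem norm_flowField_le (A B : ℝ) (p : ℝ × ℝ) :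
    ‖flowField A B p‖ ≤ (‖A‖₊ + ‖B‖₊ : ℝ≥0) := by
  push_cast
  have hc : |cos p.1 * cos p.2| ≤ 1 := by
    rw [abs_mul]; exact mul_le_one₀ (abs_cos_le_one _) (abs_nonneg _) (abs_cos_le_one _)
  have hs : |sin p.1 * sin p.2| ≤ 1 := by
    rw [abs_mul]; exact mul_le_one₀ (abs_sin_le_one _) (abs_nonneg _) (abs_sin_le_one _)
  rw [norm_eq_abs, norm_eq_abs]
  refine max_le ?_ ?_
  · change |-(A * (cos p.1 * cos p.2))| ≤ _
    rw [abs_neg, abs_mul]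
    nlinarith [abs_nonneg A, abs_nonneg B]
  · change |B * (sin p.1 * sin p.2)| ≤ _
    rw [abs_mul]
    nlinarith [abs_nonneg A, abs_nonneg B]

theorem exists_isFlow (A B a b : ℝ) : ∃ u v, IsFlow A B u v ∧ u 0 = a ∧ v 0 = b := by
  obtain ⟨γ, h0, h⟩ := exists_forall_hasDerivAt_of_lipschitzWith (lipschitzWith_flowField A B)
    (norm_flowField_le A B) (a, b)
  exact ⟨_, _, isFlow_iff.2 h, by rw [h0], by rw [h0]⟩

/-- A flow line through a saddle is constant. -/
theorem IsFlow.eq_of_saddle {A B : ℝ} {u v : ℝ → ℝ} (h : IsFlow A B u v) {t₀ : ℝ}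
    (hu : sin (u t₀) = 0) (hv : cos (v t₀) = 0) (t : ℝ) : u t = u t₀ ∧ v t = v t₀ := by
  have h' : ∀ t, HasDerivAt (fun t => (u t, v t)) (flowField A B (u t, v t)) t :=
    isFlow_iff.1 h
  have heq := ODE_solution_unique_univ (v := fun _ => flowField A B) (s := fun _ => univ)
    (t₀ := t₀) (f := fun t => (u t, v t)) (g := fun _ => (u t₀, v t₀))
    (fun _ => (lipschitzWith_flowField A B).lipschitzOnWith)
    (fun t => ⟨h' t, mem_univ _⟩) (fun t => ⟨?_, mem_univ _⟩) rfl
  · exact Prod.ext_iff.1 (congrFun heq t)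
  · convert! hasDerivAt_const t (u t₀, v t₀) using 1
    simp [flowField, hu, hv]

/-- A flow line on the separatrices does not descend from a nonnegative value to `-1`. -/
theorem IsFlow.not_tendsto_neg_one {A B : ℝ} {N M : ℕ} (hAB : A * N = B * M) (hN : 0 < N)
    (hM : 0 < M) {u v : ℝ → ℝ} (h : IsFlow A B u v) (h0 : |cos (u 0) ^ N| = |sin (v 0) ^ M|)
    (hf : 0 ≤ sin (u 0) * cos (v 0)) :
    ¬ Tendsto (fun t => sin (u t) * cos (v t)) atTop (𝓝 (-1)) := by
  intro hlim
  have hu := h.continuous_left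
  have hv := h.continuous_right
  obtain ⟨t₁, ht₁⟩ := (hlim.eventually (gt_mem_nhds (by norm_num : (-1 : ℝ) < 0))).exists
  -- Descending to -1 from a nonnegative value forces a crossing of the zero level.
  obtain ⟨t₀, ht₀⟩ := mem_range_of_exists_le_of_exists_ge
    (f := fun t => sin (u t) * cos (v t)) (by fun_prop) ⟨t₁, ht₁.le⟩ ⟨0, hf⟩
  obtain ⟨E, hE, h1, h2⟩ := h.exists_pos_cos_pow_sin_pow hAB t₀
  have heq : |cos (u t₀)| ^ N = |sin (v t₀)| ^ M := by
    rw [← abs_pow, ← abs_pow, h1, h2, abs_mul, abs_mul, h0]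
  -- On the separatrix, sin u = 0 makes |cos u| = 1, hence |sin v| = 1 and cos v = 0; the other case
  -- is symmetric. So the crossing point is a saddle, and the trajectory is constant.
  have key : sin (u t₀) = 0 ∧ cos (v t₀) = 0 := by
    have one_of : ∀ x : ℝ, sin x = 0 ↔ |cos x| = 1 := fun x => by
      rw [← sq_eq_sq₀ (abs_nonneg _) zero_le_one, sq_abs, cos_sq']; simp
    have one_of' : ∀ x : ℝ, cos x = 0 ↔ |sin x| = 1 := fun x => by
      rw [← sq_eq_sq₀ (abs_nonneg _) zero_le_one, sq_abs, sin_sq]; simp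
    rcases mul_eq_zero.1 ht₀ with hs | hs
    · refine ⟨hs, ?_⟩
      rw [(one_of _).1 hs, one_pow] at heq
      exact (one_of' _).2 ((pow_eq_one_iff_of_nonneg (abs_nonneg _) hM.ne').1 heq.symm)
    · refine ⟨?_, hs⟩
      rw [(one_of' _).1 hs, one_pow] at heq
      exact (one_of _).2 ((pow_eq_one_iff_of_nonneg (abs_nonneg _) hN.ne').1 heq)
  rw [(h.eq_of_saddle key.1 key.2 t₁).1, key.1, zero_mul] at ht₁
  exact lt_irrefl _ ht₁

/-- A flow line on the separatrices does not descend from `1` to a nonpositive value. -/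
theorem IsFlow.not_tendsto_one {A B : ℝ} {N M : ℕ} (hAB : A * N = B * M) (hN : 0 < N)
    (hM : 0 < M) {u v : ℝ → ℝ} (h : IsFlow A B u v) (h0 : |cos (u 0) ^ N| = |sin (v 0) ^ M|)
    (hf : sin (u 0) * cos (v 0) ≤ 0) :
    ¬ Tendsto (fun t => sin (u t) * cos (v t)) atBot (𝓝 1) := by
  intro hlim
  refine h.reverse_left.not_tendsto_neg_one hAB hN hM (by simpa [abs_pow] using h0)
    (by simpa using hf) ?_
  simpa [Function.comp_def] using (hlim.comp tendsto_neg_atTop_atBot).neg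

/-! ### Trajectories of the separable functions -/

theorem hasDerivAt_plane_iff {g : ℝ → Plane} {g' : Plane} {t : ℝ} :
    HasDerivAt g g' t ↔
      HasDerivAt (fun t => g t 0) (g' 0) t ∧ HasDerivAt (fun t => g t 1) (g' 1) t := by
  refine ⟨fun h => ⟨?_, ?_⟩, fun h => ?_⟩
  · exact (EuclideanSpace.proj (𝕜 := ℝ) (0 : Fin 2)).hasFDerivAt.comp_hasDerivAt t h
  · exact (EuclideanSpace.proj (𝕜 := ℝ) (1 : Fin 2)).hasFDerivAt.comp_hasDerivAt t h
  · have h' : HasDerivAt (fun t i => g t i) (fun i => g' i) t :=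
      hasDerivAt_pi.2 (Fin.forall_fin_two.2 h)
    exact (EuclideanSpace.equiv (Fin 2) ℝ).symm.hasFDerivAt.comp_hasDerivAt t h'

theorem gradient_separable (m n : ℕ) (x : Plane) :
    ∇ (fun x : Plane => separable m n (proj x)) x =
      !₂[2 * π * m * (cos (2 * π * m * x 0) * cos (2 * π * n * x 1)),
        -(2 * π * n * (sin (2 * π * m * x 0) * sin (2 * π * n * x 1)))] := by
  refine HasGradientAt.gradient ?_
  rw [hasGradientAt_iff_hasFDerivAt]
  simp only [separable_proj]
  have h0 : HasFDerivAt (fun x : Plane => x 0) (EuclideanSpace.proj (𝕜 := ℝ) (0 : Fin 2)) x :=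
    (EuclideanSpace.proj (𝕜 := ℝ) (0 : Fin 2)).hasFDerivAt
  have h1 : HasFDerivAt (fun x : Plane => x 1) (EuclideanSpace.proj (𝕜 := ℝ) (1 : Fin 2)) x :=
    (EuclideanSpace.proj (𝕜 := ℝ) (1 : Fin 2)).hasFDerivAt
  convert! ((h0.const_mul (2 * π * m)).sin).mul ((h1.const_mul (2 * π * n)).cos) using 1
  ext y
  simp [PiLp.inner_apply, Fin.sum_univ_two]
  ring

/-- Each coordinate acquires its factor twice, once from the gradient and once from the rescaling,
which is why the weights are squares. -/
theorem isGradientTrajectory_separable_iff {m n : ℕ} (hm : 0 < m) (hn : 0 < n) {γ : ℝ → Torus} :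
    IsGradientTrajectory (separable m n) γ ↔ ∃ g : ℝ → Plane, (∀ t, γ t = proj (g t)) ∧
      IsFlow ((2 * π * m) ^ 2) ((2 * π * n) ^ 2) (fun t => 2 * π * m * g t 0)
        (fun t => 2 * π * n * g t 1) := by
  have hm' : 2 * π * m ≠ 0 := by positivity
  have hn' : 2 * π * n ≠ 0 := by positivity
  refine exists_congr fun g => and_congr_right fun _ => ?_
  simp only [hasDerivAt_plane_iff, gradient_separable]
  refine ⟨fun h => ⟨fun t => ?_, fun t => ?_⟩, fun h t => ⟨?_, ?_⟩⟩
  · convert! (h t).1.const_mul (2 * π * m) using 1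
    simp; ring
  · convert! (h t).2.const_mul (2 * π * n) using 1
    simp; ring
  · convert! (h.left t).const_mul (2 * π * m)⁻¹ using 1
    · ext s; field_simp
    · simp; field_simp
  · convert! (h.right t).const_mul (2 * π * n)⁻¹ using 1
    · ext s; field_simp
    · simp; field_simp

end NeumannTorus

/-! ### Cells in the plane, the covering map and the extrema -/

namespace NeumannTorus

open Real Filter Set
open scoped Topology NNReal Gradient

/-! ### Geometry of the cells in the plane -/

theorem isOpen_squareCell (N M : ℕ) (j k : ℤ) : IsOpen (squareCell N M j k) := by
  have h1 : Continuous fun p : ℝ × ℝ => p.1 - j * π := by fun_prop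
  have h2 : Continuous fun p : ℝ × ℝ => p.2 - k * π := by fun_prop
  have h3 : Continuous fun p : ℝ × ℝ => |cos p.1 ^ N| := by fun_prop
  have h4 : Continuous fun p : ℝ × ℝ => |sin p.2 ^ M| := by fun_prop
  exact (isOpen_Ioo.preimage h1).inter ((isOpen_Ioo.preimage h2).inter (isOpen_lt h3 h4))

theorem squareCell_center_slice_mem {N M : ℕ} (hN : 0 < N) {j k : ℤ} {y : ℝ}
    (hy : y - k * π ∈ Ioo 0 π) : (j * π + π / 2, y) ∈ squareCell N M j k := by
  refine ⟨by constructor <;> simp <;> linarith [pi_pos], hy, ?_⟩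
  have h1 : cos (j * π + π / 2) = 0 := by
    rw [add_comm, cos_add_int_mul_pi, cos_pi_div_two, mul_zero]
  simp only [h1, zero_pow hN.ne', abs_zero]
  rw [← abs_sin_sub_int_mul_pi_pow _ k]
  exact abs_pos.2 (pow_ne_zero _ (sin_pos_of_mem_Ioo hy).ne')

theorem isPreconnected_squareCell {N M : ℕ} (hN : 0 < N) (j k : ℤ) :
    IsPreconnected (squareCell N M j k) := by
  set c : ℝ := j * π + π / 2 with hc
  set d : ℝ := k * π + π / 2 with hd
  have hd' : d - k * π ∈ Ioo 0 π := by constructor <;> rw [hd] <;> linarith [pi_pos]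
  refine isPreconnected_of_forall (c, d) fun p hp => ?_
  obtain ⟨h1, h2, h3⟩ := hp
  -- An L-shaped path joins the centre to p: along the vertical midline, where cos vanishes, and
  -- then horizontally at the height of p. On the horizontal leg |cos| grows with the distance from
  -- the midline, so the inequality at p implies it along the leg.
  refine ⟨{c} ×ˢ uIcc d p.2 ∪ uIcc c p.1 ×ˢ {p.2}, ?_, ?_, ?_, ?_⟩
  · rintro ⟨x, y⟩ (⟨hq1, hq2⟩ | ⟨hq1, hq2⟩)
    · obtain rfl : x = c := hq1
      refine squareCell_center_slice_mem hN ?_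
      have : ∀ x ∈ uIcc d p.2, x ∈ Ioo (k * π) (k * π + π) := by
        refine fun x hx => (ordConnected_Ioo.uIcc_subset ?_ ?_) hx
        · exact ⟨by linarith [hd'.1], by linarith [hd'.2]⟩
        · exact ⟨by linarith [h2.1], by linarith [h2.2]⟩
      have := this _ hq2
      exact ⟨by linarith [this.1], by linarith [this.2]⟩
    · obtain rfl : y = p.2 := hq2
      have hle : |x - c| ≤ |p.1 - c| := abs_sub_left_of_mem_uIcc hq1
      have hlt : |p.1 - c| < π / 2 := by
        rw [abs_lt, hc]; exact ⟨by linarith [h1.1], by linarith [h1.2]⟩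
      have habs := abs_lt.1 (hle.trans_lt hlt)
      refine ⟨⟨?_, ?_⟩, h2, lt_of_le_of_lt ?_ h3⟩
      · rw [hc] at habs; simp only; linarith [habs.1]
      · rw [hc] at habs; simp only; linarith [habs.2]
      · have key : ∀ x : ℝ, |x - c| < π / 2 → |cos x ^ N| = sin |x - c| ^ N := by
          intro x hx
          rw [← abs_sin_eq_sin_abs_of_abs_le_pi (by linarith [pi_pos]), ← abs_pow,
            ← abs_cos_sub_int_mul_pi_pow x j, show x - j * π = x - c + π / 2 by rw [hc]; ring,
            cos_add_pi_div_two, abs_pow, abs_neg, abs_pow]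
        rw [key x (hle.trans_lt hlt), key p.1 hlt]
        have h0 : 0 ≤ |x - c| := abs_nonneg _
        refine pow_le_pow_left₀ (sin_nonneg_of_nonneg_of_le_pi h0 (by linarith [pi_pos])) ?_ _
        exact sin_le_sin_of_le_of_le_pi_div_two (by linarith [pi_pos]) hlt.le hle
  · exact Or.inl ⟨rfl, left_mem_uIcc⟩
  · exact Or.inr ⟨right_mem_uIcc, rfl⟩
  · exact IsPreconnected.union (c, p.2) ⟨rfl, right_mem_uIcc⟩ ⟨left_mem_uIcc, rfl⟩
      (isPreconnected_singleton.prod isPreconnected_uIcc)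
      (isPreconnected_uIcc.prod isPreconnected_singleton)

theorem add_mem_squareCell_iff {N M : ℕ} {j k a b : ℤ} {p q : ℝ × ℝ}
    (h1 : q.1 = p.1 + a * π) (h2 : q.2 = p.2 + b * π) :
    q ∈ squareCell N M (j + a) (k + b) ↔ p ∈ squareCell N M j k := by
  have e1 : q.1 - ((j + a : ℤ) : ℝ) * π = p.1 - j * π := by rw [h1]; push_cast; ring
  have e2 : q.2 - ((k + b : ℤ) : ℝ) * π = p.2 - k * π := by rw [h2]; push_cast; ring
  have e3 : p.1 = q.1 - a * π := by rw [h1]; ring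
  have e4 : p.2 = q.2 - b * π := by rw [h2]; ring
  simp only [squareCell, mem_ofPred_eq, e1, e2]
  rw [e3, e4, abs_cos_sub_int_mul_pi_pow, abs_sin_sub_int_mul_pi_pow]

theorem eq_floor_div_pi {x : ℝ} {j : ℤ} (h : x - j * π ∈ Ioo 0 π) : j = ⌊x / π⌋ := by
  symm
  rw [Int.floor_eq_iff, le_div_iff₀ pi_pos, div_lt_iff₀ pi_pos]
  exact ⟨by linarith [h.1], by linarith [h.2]⟩

theorem sub_floor_mem_Ioo {x : ℝ} (h : sin x ≠ 0) : x - ⌊x / π⌋ * π ∈ Ioo 0 π := by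
  have h1 := Int.floor_le (x / π)
  have h2 := Int.lt_floor_add_one (x / π)
  rw [le_div_iff₀ pi_pos] at h1
  rw [div_lt_iff₀ pi_pos] at h2
  refine ⟨sub_pos.2 (h1.lt_of_ne fun he => h ?_), by linarith⟩
  rw [← he, sin_int_mul_pi]

theorem mem_squareCell_floor {N M : ℕ} (hM : 0 < M) {p : ℝ × ℝ}
    (h : |cos p.1 ^ N| < |sin p.2 ^ M|) : p ∈ squareCell N M ⌊p.1 / π⌋ ⌊p.2 / π⌋ :=
  ⟨sub_floor_mem_Ioo (sin_ne_zero_of_abs_cos_pow_lt (abs_sin_pow_le_one _ _) h),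
    sub_floor_mem_Ioo (sin_ne_zero_of_abs_lt_abs_sin_pow hM h), h⟩

/-! ### The covering map -/

theorem continuous_proj : Continuous proj := by
  refine continuous_pi fun i => ?_
  exact (AddCircle.continuous_mk' 1).comp (EuclideanSpace.proj (𝕜 := ℝ) i).continuous

theorem isOpenMap_proj : IsOpenMap proj := by
  have h : IsOpenMap (Pi.map fun (_ : Fin 2) (x : ℝ) => (x : UnitAddCircle)) :=
    IsOpenMap.piMap (fun _ => QuotientAddGroup.isOpenMap_coe)
      (.of_forall fun _ => QuotientAddGroup.mk_surjective)
  exact h.comp (PiLp.homeomorph 2 fun _ : Fin 2 => ℝ).isOpenMap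

theorem coe_eq_coe_iff_exists_int {x y : ℝ} :
    (x : UnitAddCircle) = (y : UnitAddCircle) ↔ ∃ a : ℤ, x = y + a := by
  rw [← sub_eq_zero, ← AddCircle.coe_sub, AddCircle.coe_eq_zero_iff]
  refine exists_congr fun a => ?_
  rw [zsmul_eq_mul, mul_one, eq_sub_iff_add_eq, eq_comm, add_comm]

theorem proj_eq_proj_iff {x y : Plane} :
    proj x = proj y ↔ ∃ a b : ℤ, x 0 = y 0 + a ∧ x 1 = y 1 + b := by
  simp only [funext_iff, Fin.forall_fin_two, proj, coe_eq_coe_iff_exists_int]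
  exact ⟨fun ⟨⟨a, ha⟩, b, hb⟩ => ⟨a, b, ha, hb⟩, fun ⟨a, b, ha, hb⟩ => ⟨⟨a, ha⟩, b, hb⟩⟩

/-- Every point of the torus has a lift to a given fundamental domain. -/
theorem exists_proj_eq (a b : ℝ) (z : Torus) :
    ∃ x : Plane, proj x = z ∧ x 0 ∈ Ico a (a + 1) ∧ x 1 ∈ Ico b (b + 1) := by
  have h : ∀ (a : ℝ) (w : UnitAddCircle), ∃ x : ℝ, (x : UnitAddCircle) = w ∧ x ∈ Ico a (a + 1) :=
    fun a w => ⟨AddCircle.equivIco 1 a w, (AddCircle.equivIco 1 a).symm_apply_apply w,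
      (AddCircle.equivIco 1 a w).2⟩
  obtain ⟨x, hx, hx'⟩ := h a (z 0)
  obtain ⟨y, hy, hy'⟩ := h b (z 1)
  refine ⟨!₂[x, y], ?_, hx', hy'⟩
  funext i
  fin_cases i
  · exact hx
  · exact hy

theorem proj_surjective : Function.Surjective proj := fun z =>
  (exists_proj_eq 0 0 z).imp fun _ h => h.1

theorem isQuotientMap_proj : Topology.IsQuotientMap proj :=
  isOpenMap_proj.isQuotientMap continuous_proj proj_surjective

theorem continuous_separable (m n : ℕ) : Continuous (separable m n) := by
  rw [isQuotientMap_proj.continuous_iff]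
  change Continuous fun x => separable m n (proj x)
  simp only [separable_proj]
  fun_prop

theorem abs_separable_le_one (m n : ℕ) (z : Torus) : |separable m n z| ≤ 1 := by
  obtain ⟨x, rfl⟩ := proj_surjective z
  rw [separable_proj, abs_mul]
  exact mul_le_one₀ (abs_sin_le_one _) (abs_nonneg _) (abs_cos_le_one _)

/-! ### Local extrema -/

/-- The sign ε treats minima and maxima together. A critical point is either a saddle (sin u = cos v
= 0) or has value ±1; saddles and the value +1 are excluded by a direction in which the function
decreases. -/
theorem mul_separable_eq_neg_one_of_isLocalMin {m n : ℕ} (hm : 0 < m) (hn : 0 < n) {ε : ℝ}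
    (hε : ε ^ 2 = 1) {z : Torus} (h : IsLocalMin (fun z => ε * separable m n z) z) :
    ε * separable m n z = -1 := by
  obtain ⟨x, rfl⟩ := proj_surjective z
  have hε0 : ε ≠ 0 := by rintro rfl; norm_num at hε
  have hm' : 0 < 2 * π * m := by positivity
  have hn' : 0 < 2 * π * n := by positivity
  have hx : IsLocalMin (fun x => ε * separable m n (proj x)) x :=
    h.comp_continuous continuous_proj.continuousAt
  have hgrad : ∇ (fun x : Plane => separable m n (proj x)) x = 0 := by
    have h1 : IsLocalMin (fun x => ε * separable m n (proj x)) x := hx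
    have h2 := h1.fderiv_eq_zero
    have h3 : fderiv ℝ (fun x : Plane => ε * separable m n (proj x)) x =
        ε • fderiv ℝ (fun x : Plane => separable m n (proj x)) x :=
      congrFun (fderiv_const_smul_field (𝕜 := ℝ) (f := fun x : Plane => separable m n (proj x)) ε) x
    rw [h3, smul_eq_zero, or_iff_right hε0] at h2
    rw [gradient, h2, map_zero]
  rw [gradient_separable] at hgrad
  have g0 : cos (2 * π * m * x 0) * cos (2 * π * n * x 1) = 0 := by
    simpa [hm'.ne', pi_ne_zero, hm.ne'] using congrArg (fun y : Plane => y 0) hgrad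
  have g1 : sin (2 * π * m * x 0) * sin (2 * π * n * x 1) = 0 := by
    simpa [hn'.ne', pi_ne_zero, hn.ne'] using congrArg (fun y : Plane => y 1) hgrad
  have hpath : ∀ a b : ℝ, ∃ s > 0, 2 * π * m * s < π / 2 ∧ 2 * π * n * s < π / 2 ∧
      ε * separable m n (proj x) ≤
        ε * (sin (2 * π * m * x 0 + a * (2 * π * m * s)) *
          cos (2 * π * n * x 1 + b * (2 * π * n * s))) := by
    intro a b
    have hc : Continuous fun s : ℝ => x + s • (!₂[a, b] : Plane) := by fun_prop
    have h0 : x + (0 : ℝ) • (!₂[a, b] : Plane) = x := by simp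
    have h1 : IsLocalMin (fun s : ℝ => ε * separable m n (proj (x + s • (!₂[a, b] : Plane)))) 0 := by
      have : IsLocalMin (fun x => ε * separable m n (proj x)) (x + (0 : ℝ) • (!₂[a, b] : Plane)) := by
        rwa [h0]
      exact this.comp_continuous (g := fun s : ℝ => x + s • (!₂[a, b] : Plane)) hc.continuousAt
    have e1 : ∀ᶠ s : ℝ in 𝓝[>] 0, 2 * π * m * s < π / 2 := by
      refine (Continuous.tendsto (by fun_prop) 0 |>.eventually (gt_mem_nhds ?_)).filter_mono
        nhdsWithin_le_nhds
      simp; positivity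
    have e2 : ∀ᶠ s : ℝ in 𝓝[>] 0, 2 * π * n * s < π / 2 := by
      refine (Continuous.tendsto (by fun_prop) 0 |>.eventually (gt_mem_nhds ?_)).filter_mono
        nhdsWithin_le_nhds
      simp; positivity
    obtain ⟨s, ⟨⟨h2, h3⟩, h4⟩, h5⟩ := (((h1.filter_mono nhdsWithin_le_nhds).and e1).and e2).and
      (eventually_mem_nhdsWithin (a := (0 : ℝ)) (s := Ioi 0)) |>.exists
    refine ⟨s, h5, h3, h4, ?_⟩
    simp only [h0] at h2
    rw [separable_proj m n (x + _)] at h2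
    have f0 : 2 * π * m * (x + s • (!₂[a, b] : Plane)) 0 =
        2 * π * m * x 0 + a * (2 * π * m * s) := by simp; ring
    have f1 : 2 * π * n * (x + s • (!₂[a, b] : Plane)) 1 =
        2 * π * n * x 1 + b * (2 * π * n * s) := by simp; ring
    rwa [f0, f1] at h2
  rw [separable_proj] at hpath ⊢
  set u := 2 * π * m * x 0
  set v := 2 * π * n * x 1
  have su := sin_sq_add_cos_sq u
  have sv := sin_sq_add_cos_sq v
  by_cases hu : sin u = 0
  · have hcu : cos u ≠ 0 := by
      intro h; rw [hu, h] at su; norm_num at su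
    have hcv : cos v = 0 := (mul_eq_zero.1 g0).resolve_left hcu
    -- At a saddle the second slope is the sign ε·cos u·sin v = ±1; along this diagonal the value
    -- becomes minus a product of two positive sines.
    obtain ⟨s, hs, h1, h2, h3⟩ := hpath 1 (ε * cos u * sin v)
    rw [hu, zero_mul, mul_zero, one_mul, sin_add, cos_add, hu, hcv] at h3
    have hσ : (ε * cos u * sin v) ^ 2 = 1 := by
      rw [mul_pow, mul_pow, hε]
      rw [hu] at su; rw [hcv] at sv
      nlinarith
    have hp1 := sin_pos_of_pos_of_lt_pi (mul_pos hm' hs) (by linarith [pi_pos])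
    have hp2 := sin_pos_of_pos_of_lt_pi (mul_pos hn' hs) (by linarith [pi_pos])
    rcases sq_eq_one_iff.1 hσ with hσ' | hσ' <;> rw [hσ'] at h3
    · rw [one_mul] at h3
      have h4 := mul_pos hp1 hp2
      refine absurd h3 (not_le.2 ?_)
      linear_combination h4 - sin (2 * π * m * s) * sin (2 * π * n * s) * hσ'
    · rw [neg_one_mul, sin_neg] at h3
      have h4 := mul_pos hp1 hp2
      refine absurd h3 (not_le.2 ?_)
      linear_combination h4 + sin (2 * π * m * s) * sin (2 * π * n * s) * hσ'
  · have hsv : sin v = 0 := (mul_eq_zero.1 g1).resolve_left hu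
    have hcv : cos v ≠ 0 := by
      intro h; rw [hsv, h] at sv; norm_num at sv
    have hcu : cos u = 0 := (mul_eq_zero.1 g0).resolve_right hcv
    have hf : (ε * (sin u * cos v)) ^ 2 = 1 := by
      rw [mul_pow, mul_pow, hε]
      rw [hcu] at su; rw [hsv] at sv
      nlinarith
    rcases sq_eq_one_iff.1 hf with hf' | hf'
    · obtain ⟨s, hs, h1, -, h3⟩ := hpath 1 0
      rw [hf', one_mul, zero_mul, add_zero, sin_add, hcu, zero_mul, add_zero] at h3
      have h4 : ε * (sin u * cos (2 * π * m * s) * cos v) = cos (2 * π * m * s) := by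
        linear_combination cos (2 * π * m * s) * hf'
      rw [h4] at h3
      have := cos_lt_cos_of_nonneg_of_le_pi_div_two le_rfl h1.le (mul_pos hm' hs)
      rw [cos_zero] at this
      linarith
    · exact hf'

theorem separable_eq_neg_one_of_isLocalMin {m n : ℕ} (hm : 0 < m) (hn : 0 < n) {z : Torus}
    (h : IsLocalMin (separable m n) z) : separable m n z = -1 := by
  simpa using mul_separable_eq_neg_one_of_isLocalMin hm hn (ε := 1) (by norm_num) (by simpa using h)

theorem separable_eq_one_of_isLocalMax {m n : ℕ} (hm : 0 < m) (hn : 0 < n) {z : Torus}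
    (h : IsLocalMax (separable m n) z) : separable m n z = 1 := by
  have := mul_separable_eq_neg_one_of_isLocalMin hm hn (ε := -1) (by norm_num) (z := z)
    (by simpa using h.neg)
  linarith

theorem isLocalMin_of_separable_eq {m n : ℕ} {z : Torus} (h : separable m n z = -1) :
    IsLocalMin (separable m n) z :=
  .of_forall fun w => h.le.trans (abs_le.1 (abs_separable_le_one m n w)).1

theorem isLocalMax_of_separable_eq {m n : ℕ} {z : Torus} (h : separable m n z = 1) :
    IsLocalMax (separable m n) z :=
  .of_forall fun w => (abs_le.1 (abs_separable_le_one m n w)).2.trans h.ge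

/-! ### Lifts of trajectories -/

theorem exists_trajectory {m n : ℕ} (hm : 0 < m) (hn : 0 < n) (z : Torus) :
    ∃ γ, IsGradientTrajectory (separable m n) γ ∧ γ 0 = z := by
  obtain ⟨x, rfl⟩ := proj_surjective z
  have hm' : 2 * π * m ≠ 0 := by positivity
  have hn' : 2 * π * n ≠ 0 := by positivity
  obtain ⟨u, v, h, hu, hv⟩ := exists_isFlow ((2 * π * m) ^ 2) ((2 * π * n) ^ 2)
    (2 * π * m * x 0) (2 * π * n * x 1)
  refine ⟨fun t => proj !₂[u t / (2 * π * m), v t / (2 * π * n)],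
    (isGradientTrajectory_separable_iff hm hn).2 ⟨_, fun _ => rfl, ?_⟩, ?_⟩
  · convert! h using 1
    · ext t; simp; field_simp
    · ext t; simp; field_simp
  · refine congrArg proj ?_
    ext i
    fin_cases i
    · simp only [hu, Fin.zero_eta, Matrix.cons_val_zero]
      field_simp
    · simp only [hv, Fin.mk_one, Matrix.cons_val_one, Matrix.cons_val_fin_one]
      field_simp

/-- A trajectory carries some lift by definition. Two lifts of one point differ by integers (a, b),
which shift the phases by the even multiples 2ma and 2nb of π, so the lift can be translated to
start at x without path lifting. -/
theorem IsGradientTrajectory.exists_lift {m n : ℕ} (hm : 0 < m) (hn : 0 < n) {γ : ℝ → Torus}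
    (h : IsGradientTrajectory (separable m n) γ) {x : Plane} (h0 : γ 0 = proj x) :
    ∃ g : ℝ → Plane, (∀ t, γ t = proj (g t)) ∧ g 0 = x ∧
      IsFlow ((2 * π * m) ^ 2) ((2 * π * n) ^ 2) (fun t => 2 * π * m * g t 0)
        (fun t => 2 * π * n * g t 1) := by
  obtain ⟨g, hg, hflow⟩ := (isGradientTrajectory_separable_iff hm hn).1 h
  obtain ⟨a, b, ha, hb⟩ := proj_eq_proj_iff.1 ((hg 0).symm.trans h0)
  refine ⟨fun t => g t - !₂[(a : ℝ), (b : ℝ)], fun t => (hg t).trans ?_, ?_, ?_⟩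
  · exact proj_eq_proj_iff.2 ⟨a, b, by simp, by simp⟩
  · ext i
    fin_cases i
    · simp [ha]
    · simp [hb]
  · have heven : Even (2 * m * a + 2 * n * b : ℤ) := ⟨m * a + n * b, by ring⟩
    convert! hflow.sub_int_mul_pi heven using 1
    · ext t; simp; ring
    · ext t; simp; ring

end NeumannTorus

/-! ### Identification and enumeration of the Neumann domains -/

namespace NeumannTorus

open Real Filter Set
open scoped Topology

/-! ### Cells on the torus -/

/-- A global coordinate system of the plane in which the gradient flow of `separable m n` is
a flow in the sense of `IsFlow`, and in which the lattice of periods is `Kπℤ × Lπℤ`. -/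
structure IsAdaptedChart (m n : ℕ) (φ : Plane ≃ₜ ℝ × ℝ) (A B : ℝ) (N M : ℕ) (K L : ℤ) : Prop where
  balance : A * N = B * M
  left_pos : 0 < N
  right_pos : 0 < M
  weight_pos : 0 < B
  flow : ∀ g : ℝ → Plane, IsFlow ((2 * π * m) ^ 2) ((2 * π * n) ^ 2) (fun t => 2 * π * m * g t 0)
    (fun t => 2 * π * n * g t 1) → IsFlow A B (fun t => (φ (g t)).1) (fun t => (φ (g t)).2)
  value : ∀ x, separable m n (proj x) = sin (φ x).1 * cos (φ x).2
  period : ∀ x y, proj x = proj y → ∃ a b : ℤ,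
    (φ x).1 = (φ y).1 + (a * K : ℤ) * π ∧ (φ x).2 = (φ y).2 + (b * L : ℤ) * π
  exists_lift : ∀ z, ∃ x, proj x = z ∧ (φ x).1 ∈ Ico 0 (K * π) ∧ (φ x).2 ∈ Ico 0 (L * π)

/-- The image in the torus of a cell in the plane. -/
def torusCell (φ : Plane ≃ₜ ℝ × ℝ) (N M : ℕ) (j k : ℤ) : Set Torus :=
  proj '' (φ ⁻¹' squareCell N M j k)

section torusCell

variable {φ : Plane ≃ₜ ℝ × ℝ} {N M : ℕ} {j k : ℤ}

theorem isOpen_torusCell : IsOpen (torusCell φ N M j k) :=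
  isOpenMap_proj _ ((isOpen_squareCell N M j k).preimage φ.continuous)

theorem isPreconnected_torusCell (hN : 0 < N) : IsPreconnected (torusCell φ N M j k) := by
  refine IsPreconnected.image ?_ _ continuous_proj.continuousOn
  rw [φ.isPreconnected_preimage]
  exact isPreconnected_squareCell hN j k

theorem torusCell_nonempty (hN : 0 < N) : (torusCell φ N M j k).Nonempty := by
  refine Nonempty.image _ ⟨φ.symm (j * π + π / 2, k * π + π / 2), ?_⟩
  rw [mem_preimage, φ.apply_symm_apply]
  exact squareCell_center_slice_mem hN (by constructor <;> linarith [pi_pos])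

end torusCell

namespace IsAdaptedChart

variable {m n : ℕ} {φ : Plane ≃ₜ ℝ × ℝ} {A B : ℝ} {N M : ℕ} {K L : ℤ}

theorem abs_cos_pow_eq_of_proj_eq (h : IsAdaptedChart m n φ A B N M K L) {x y : Plane}
    (hxy : proj x = proj y) : |cos (φ x).1 ^ N| = |cos (φ y).1 ^ N| ∧
      |sin (φ x).2 ^ M| = |sin (φ y).2 ^ M| := by
  obtain ⟨a, b, ha, hb⟩ := h.period x y hxy
  rw [ha, hb, ← abs_cos_sub_int_mul_pi_pow _ (a * K), ← abs_sin_sub_int_mul_pi_pow _ (b * L)]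
  simp

/-- Preimages of one point differ by periods, so the square indices agree modulo K and L; in the
ranges [0, K) and [0, L) they are equal. -/
theorem eq_of_mem_torusCell (h : IsAdaptedChart m n φ A B N M K L) {j k j' k' : ℤ}
    (hj : j ∈ Ico 0 K) (hk : k ∈ Ico 0 L) (hj' : j' ∈ Ico 0 K) (hk' : k' ∈ Ico 0 L) {z : Torus}
    (hz : z ∈ torusCell φ N M j k) (hz' : z ∈ torusCell φ N M j' k') : j = j' ∧ k = k' := by
  obtain ⟨x, hx, rfl⟩ := hz
  obtain ⟨y, hy, hxy⟩ := hz'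
  obtain ⟨a, b, ha, hb⟩ := h.period y x hxy
  rw [mem_preimage, ← add_mem_squareCell_iff ha hb] at hx
  have e1 : j + a * K = j' := (eq_floor_div_pi hx.1).trans (eq_floor_div_pi hy.1).symm
  have e2 : k + b * L = k' := (eq_floor_div_pi hx.2.1).trans (eq_floor_div_pi hy.2.1).symm
  constructor
  · rw [← Int.emod_eq_of_lt hj.1 hj.2, ← Int.emod_eq_of_lt hj'.1 hj'.2, ← e1,
      Int.add_mul_emod_self_right]
  · rw [← Int.emod_eq_of_lt hk.1 hk.2, ← Int.emod_eq_of_lt hk'.1 hk'.2, ← e2,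
      Int.add_mul_emod_self_right]

theorem exists_mem_torusCell (h : IsAdaptedChart m n φ A B N M K L) {x : Plane}
    (hx : |cos (φ x).1 ^ N| < |sin (φ x).2 ^ M|) :
    ∃ j ∈ Ico 0 K, ∃ k ∈ Ico 0 L, proj x ∈ torusCell φ N M j k := by
  obtain ⟨y, hy, h1, h2⟩ := h.exists_lift (proj x)
  obtain ⟨e1, e2⟩ := h.abs_cos_pow_eq_of_proj_eq hy
  rw [← e1, ← e2] at hx
  refine ⟨_, ⟨?_, ?_⟩, _, ⟨?_, ?_⟩, y, mem_squareCell_floor h.right_pos hx, hy⟩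
  · exact Int.floor_nonneg.2 (div_nonneg h1.1 pi_pos.le)
  · exact Int.floor_lt.2 ((div_lt_iff₀ pi_pos).2 h1.2)
  · exact Int.floor_nonneg.2 (div_nonneg h2.1 pi_pos.le)
  · exact Int.floor_lt.2 ((div_lt_iff₀ pi_pos).2 h2.2)

theorem exists_limits_torusCell (h : IsAdaptedChart m n φ A B N M K L) (hm : 0 < m) (hn : 0 < n)
    (j k : ℤ) : ∃ p q : Torus, separable m n p = -1 ∧ separable m n q = 1 ∧
      ∀ γ, IsGradientTrajectory (separable m n) γ → γ 0 ∈ torusCell φ N M j k →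
        Tendsto γ atTop (𝓝 p) ∧ Tendsto γ atBot (𝓝 q) := by
  obtain ⟨p, q, hp, hq, hlim⟩ :=
    exists_limits_squareCell h.balance h.left_pos h.right_pos h.weight_pos j k
  refine ⟨proj (φ.symm p), proj (φ.symm q), ?_, ?_, fun γ hγ h0 => ?_⟩
  · rw [h.value, φ.apply_symm_apply, hp]
  · rw [h.value, φ.apply_symm_apply, hq]
  · obtain ⟨x, hx, hx0⟩ := h0
    obtain ⟨g, hg, rfl, hflow⟩ := hγ.exists_lift hm hn hx0.symm
    obtain ⟨⟨h1, h2⟩, h3, h4⟩ := hlim _ _ (h.flow g hflow) hx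
    have hcont : Continuous fun w => proj (φ.symm w) := continuous_proj.comp φ.symm.continuous
    have e : γ = fun t => proj (φ.symm ((φ (g t)).1, (φ (g t)).2)) := by
      funext t; rw [hg t, Prod.mk.eta, φ.symm_apply_apply]
    rw [e]
    exact ⟨(hcont.tendsto p).comp (h1.prodMk_nhds h2), (hcont.tendsto q).comp (h3.prodMk_nhds h4)⟩

end IsAdaptedChart

/-- The homeomorphism `x ↦ (a x₀, b x₁)`. -/
noncomputable def scaleChart (a b : ℝ) (ha : a ≠ 0) (hb : b ≠ 0) : Plane ≃ₜ ℝ × ℝ where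
  toFun x := (a * x 0, b * x 1)
  invFun p := !₂[a⁻¹ * p.1, b⁻¹ * p.2]
  left_inv x := by
    ext i
    fin_cases i <;> simp [ha, hb]
  right_inv p := by simp [ha, hb]
  continuous_toFun := by fun_prop
  continuous_invFun := by fun_prop

/-- The homeomorphism `x ↦ (b x₁ + π / 2, a x₀ - π / 2)`. -/
noncomputable def swapChart (a b : ℝ) (ha : a ≠ 0) (hb : b ≠ 0) : Plane ≃ₜ ℝ × ℝ where
  toFun x := (b * x 1 + π / 2, a * x 0 - π / 2)
  invFun p := !₂[a⁻¹ * (p.2 + π / 2), b⁻¹ * (p.1 - π / 2)]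
  left_inv x := by
    ext i
    fin_cases i <;> simp [ha, hb]
  right_inv p := by simp [ha, hb]
  continuous_toFun := by fun_prop
  continuous_invFun := by fun_prop

section charts

variable {m n : ℕ} (hm : 0 < m) (hn : 0 < n) (ha : 2 * π * m ≠ 0) (hb : 2 * π * n ≠ 0)

include hm hn

theorem isAdaptedChart_scaleChart :
    IsAdaptedChart m n (scaleChart (2 * π * m) (2 * π * n) ha hb) ((2 * π * m) ^ 2)
      ((2 * π * n) ^ 2) (n ^ 2) (m ^ 2) (2 * m) (2 * n) where
  balance := by push_cast; ring
  left_pos := by positivity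
  right_pos := by positivity
  weight_pos := by positivity
  flow g h := h
  value x := separable_proj m n x
  period x y hxy := by
    obtain ⟨a, b, h1, h2⟩ := proj_eq_proj_iff.1 hxy
    refine ⟨a, b, ?_, ?_⟩
    · simp only [scaleChart, Homeomorph.homeomorph_mk_coe, Equiv.coe_fn_mk, h1]
      push_cast; ring
    · simp only [scaleChart, Homeomorph.homeomorph_mk_coe, Equiv.coe_fn_mk, h2]
      push_cast; ring
  exists_lift z := by
    obtain ⟨x, hx, h1, h2⟩ := exists_proj_eq 0 0 z
    have hm' : 0 < 2 * π * m := by positivity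
    have hn' : 0 < 2 * π * n := by positivity
    refine ⟨x, hx, ⟨mul_nonneg hm'.le h1.1, ?_⟩, mul_nonneg hn'.le h2.1, ?_⟩
    · change 2 * π * m * x 0 < _
      have := mul_lt_mul_of_pos_left h1.2 hm'
      push_cast; linarith
    · change 2 * π * n * x 1 < _
      have := mul_lt_mul_of_pos_left h2.2 hn'
      push_cast; linarith

theorem isAdaptedChart_swapChart :
    IsAdaptedChart m n (swapChart (2 * π * m) (2 * π * n) ha hb) ((2 * π * n) ^ 2)
      ((2 * π * m) ^ 2) (m ^ 2) (n ^ 2) (2 * n) (2 * m) where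
  balance := by push_cast; ring
  left_pos := by positivity
  right_pos := by positivity
  weight_pos := by positivity
  flow g h := h.swap
  value x := by
    simp only [swapChart, Homeomorph.homeomorph_mk_coe, Equiv.coe_fn_mk, separable_proj,
      sin_add_pi_div_two, cos_sub_pi_div_two]
    ring
  period x y hxy := by
    obtain ⟨a, b, h1, h2⟩ := proj_eq_proj_iff.1 hxy
    refine ⟨b, a, ?_, ?_⟩
    · simp only [swapChart, Homeomorph.homeomorph_mk_coe, Equiv.coe_fn_mk, h2]
      push_cast; ring
    · simp only [swapChart, Homeomorph.homeomorph_mk_coe, Equiv.coe_fn_mk, h1]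
      push_cast; ring
  exists_lift z := by
    have hm' : 0 < 2 * π * m := by positivity
    have hn' : 0 < 2 * π * n := by positivity
    -- The corner of the fundamental domain compensates the shifts ±π/2 of the chart, so that the
    -- chart coordinates start at 0.
    obtain ⟨x, hx, h1, h2⟩ := exists_proj_eq (π / 2 / (2 * π * m)) (-(π / 2 / (2 * π * n))) z
    have e1 : 2 * π * m * (π / 2 / (2 * π * m)) = π / 2 := mul_div_cancel₀ _ ha
    have e2 : 2 * π * n * (π / 2 / (2 * π * n)) = π / 2 := mul_div_cancel₀ _ hb
    have f1 := mul_le_mul_of_nonneg_left h1.1 hm'.le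
    have f2 := mul_le_mul_of_nonneg_left h2.1 hn'.le
    have f3 := mul_lt_mul_of_pos_left h1.2 hm'
    have f4 := mul_lt_mul_of_pos_left h2.2 hn'
    refine ⟨x, hx, ?_, ?_⟩
    · change 2 * π * n * x 1 + π / 2 ∈ _
      constructor
      · linarith
      · push_cast; linarith
    · change 2 * π * m * x 0 - π / 2 ∈ _
      constructor
      · linarith
      · push_cast; linarith

end charts

/-! ### The number of Neumann domains -/

/-- The index set of the Neumann domains of `separable m n`. -/
abbrev CellIndex (m n : ℕ) : Type := (Fin (2 * m) × Fin (2 * n)) ⊕ (Fin (2 * n) × Fin (2 * m))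

section count

variable {m n : ℕ} (hm : 0 < m) (hn : 0 < n)

/-- The cells of `separable m n` on the torus. -/
def cell : CellIndex m n → Set Torus :=
  have ha : 2 * π * m ≠ 0 := by positivity
  have hb : 2 * π * n ≠ 0 := by positivity
  Sum.elim
    (fun e => torusCell (scaleChart (2 * π * m) (2 * π * n) ha hb) (n ^ 2) (m ^ 2) (e.1 : ℕ)
      (e.2 : ℕ))
    (fun e => torusCell (swapChart (2 * π * m) (2 * π * n) ha hb) (m ^ 2) (n ^ 2) (e.1 : ℕ)
      (e.2 : ℕ))

theorem isOpen_cell (e : CellIndex m n) : IsOpen (cell hm hn e) := by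
  rcases e with e | e <;> exact isOpen_torusCell

theorem isPreconnected_cell (e : CellIndex m n) : IsPreconnected (cell hm hn e) := by
  rcases e with e | e <;> exact isPreconnected_torusCell (by positivity)

theorem cell_nonempty (e : CellIndex m n) : (cell hm hn e).Nonempty := by
  rcases e with e | e <;> exact torusCell_nonempty (by positivity)

theorem exists_limits_cell (e : CellIndex m n) :
    ∃ p q : Torus, separable m n p = -1 ∧ separable m n q = 1 ∧
      ∀ γ, IsGradientTrajectory (separable m n) γ → γ 0 ∈ cell hm hn e →
        Tendsto γ atTop (𝓝 p) ∧ Tendsto γ atBot (𝓝 q) := by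
  rcases e with e | e
  · exact (isAdaptedChart_scaleChart hm hn _ _).exists_limits_torusCell hm hn _ _
  · exact (isAdaptedChart_swapChart hm hn _ _).exists_limits_torusCell hm hn _ _

theorem lt_of_mem_cell_inl {e : Fin (2 * m) × Fin (2 * n)} {x : Plane}
    (h : proj x ∈ cell hm hn (.inl e)) :
    |cos (2 * π * m * x 0) ^ n ^ 2| < |sin (2 * π * n * x 1) ^ m ^ 2| := by
  obtain ⟨y, hy, hxy⟩ := h
  obtain ⟨h1, h2⟩ := (isAdaptedChart_scaleChart hm hn _ _).abs_cos_pow_eq_of_proj_eq hxy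
  exact h1 ▸ h2 ▸ hy.2.2

theorem swapChart_lt_iff {a b : ℝ} (ha : a ≠ 0) (hb : b ≠ 0) {N M : ℕ} {x : Plane} :
    |cos (swapChart a b ha hb x).1 ^ M| < |sin (swapChart a b ha hb x).2 ^ N| ↔
      |sin (b * x 1) ^ M| < |cos (a * x 0) ^ N| := by
  simp [swapChart, cos_add_pi_div_two, sin_sub_pi_div_two, abs_pow]

theorem lt_of_mem_cell_inr {e : Fin (2 * n) × Fin (2 * m)} {x : Plane}
    (h : proj x ∈ cell hm hn (.inr e)) :
    |sin (2 * π * n * x 1) ^ m ^ 2| < |cos (2 * π * m * x 0) ^ n ^ 2| := by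
  have ha : 2 * π * m ≠ 0 := by positivity
  have hb : 2 * π * n ≠ 0 := by positivity
  obtain ⟨y, hy, hxy⟩ := h
  obtain ⟨h1, h2⟩ := (isAdaptedChart_swapChart hm hn ha hb).abs_cos_pow_eq_of_proj_eq hxy
  rw [← swapChart_lt_iff ha hb, ← h1, ← h2]
  exact hy.2.2

/-- Cells of the same kind are separated by their indices modulo periods, cells of different kinds
by opposite strict inequalities. -/
theorem disjoint_cell {e e' : CellIndex m n} (hee : e ≠ e') :
    Disjoint (cell hm hn e) (cell hm hn e') := by
  have ha : 2 * π * m ≠ 0 := by positivity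
  have hb : 2 * π * n ≠ 0 := by positivity
  have hlt : ∀ {k : ℕ} (i : Fin (2 * k)), ((i : ℕ) : ℤ) ∈ Ico (0 : ℤ) (2 * k) := fun i =>
    ⟨by positivity, by exact_mod_cast i.2⟩
  rw [Set.disjoint_left]
  intro z hz hz'
  obtain ⟨x, rfl⟩ := proj_surjective z
  refine hee ?_
  rcases e with e | e <;> rcases e' with e' | e'
  · obtain ⟨h1, h2⟩ := (isAdaptedChart_scaleChart hm hn ha hb).eq_of_mem_torusCell
      (hlt e.1) (hlt e.2) (hlt e'.1) (hlt e'.2) hz hz'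
    exact congrArg _ (Prod.ext (Fin.ext (by exact_mod_cast h1)) (Fin.ext (by exact_mod_cast h2)))
  · exact absurd (lt_of_mem_cell_inl hm hn hz) (lt_of_mem_cell_inr hm hn hz').not_gt
  · exact absurd (lt_of_mem_cell_inr hm hn hz) (lt_of_mem_cell_inl hm hn hz').not_gt
  · obtain ⟨h1, h2⟩ := (isAdaptedChart_swapChart hm hn ha hb).eq_of_mem_torusCell
      (hlt e.1) (hlt e.2) (hlt e'.1) (hlt e'.2) hz hz'
    exact congrArg _ (Prod.ext (Fin.ext (by exact_mod_cast h1)) (Fin.ext (by exact_mod_cast h2)))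

theorem exists_mem_cell {x : Plane}
    (h : |cos (2 * π * m * x 0) ^ n ^ 2| ≠ |sin (2 * π * n * x 1) ^ m ^ 2|) :
    ∃ e, proj x ∈ cell hm hn e := by
  have ha : 2 * π * m ≠ 0 := by positivity
  have hb : 2 * π * n ≠ 0 := by positivity
  have hcast : ∀ {k : ℕ} {j : ℤ}, j ∈ Ico (0 : ℤ) (2 * k) →
      ∃ i : Fin (2 * k), ((i : ℕ) : ℤ) = j := by
    intro k j hj
    exact ⟨⟨j.toNat, by have := hj.1; have := hj.2; omega⟩, Int.toNat_of_nonneg hj.1⟩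
  rcases lt_or_gt_of_ne h with h | h
  · obtain ⟨j, hj, k, hk, hx⟩ := (isAdaptedChart_scaleChart hm hn ha hb).exists_mem_torusCell h
    obtain ⟨j, rfl⟩ := hcast hj
    obtain ⟨k, rfl⟩ := hcast hk
    exact ⟨.inl (j, k), hx⟩
  · obtain ⟨j, hj, k, hk, hx⟩ := (isAdaptedChart_swapChart hm hn ha hb).exists_mem_torusCell
      ((swapChart_lt_iff ha hb).2 h)
    obtain ⟨j, rfl⟩ := hcast hj
    obtain ⟨k, rfl⟩ := hcast hk
    exact ⟨.inr (j, k), hx⟩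

include hm hn in
/-- Points on the separatrices do not flow from a maximum to a minimum. -/
theorem abs_ne_of_mem_stable_inter_unstable {p q : Torus} (hp : separable m n p = -1)
    (hq : separable m n q = 1) {x : Plane}
    (hx : proj x ∈ stableManifold (separable m n) p ∩ unstableManifold (separable m n) q) :
    |cos (2 * π * m * x 0) ^ n ^ 2| ≠ |sin (2 * π * n * x 1) ^ m ^ 2| := by
  intro heq
  have hbal : (2 * π * m) ^ 2 * (n ^ 2 : ℕ) = (2 * π * n) ^ 2 * (m ^ 2 : ℕ) := by push_cast; ring
  have hM : 0 < m ^ 2 := by positivity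
  have hN : 0 < n ^ 2 := by positivity
  obtain ⟨⟨γ, hγ, h0, hlim⟩, ⟨γ', hγ', h0', hlim'⟩⟩ := hx
  obtain ⟨g, hg, rfl, hflow⟩ := hγ.exists_lift hm hn h0
  obtain ⟨g', hg', hgg', hflow'⟩ := hγ'.exists_lift hm hn h0'
  have hcont := continuous_separable m n
  -- The sign of the value at the point decides which end is impossible: from f ≥ 0 the minimum is
  -- out of reach forwards, and from f ≤ 0 the maximum is out of reach backwards.
  rcases le_total 0 (sin (2 * π * m * g 0 0) * cos (2 * π * n * g 0 1)) with hs | hs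
  · refine hflow.not_tendsto_neg_one hbal hN hM heq hs ?_
    have := (hcont.tendsto p).comp hlim
    rw [hp] at this
    refine this.congr fun t => ?_
    rw [Function.comp_apply, hg t, separable_proj]
  · rw [← hgg'] at heq hs
    refine hflow'.not_tendsto_one hbal hN hM heq hs ?_
    have := (hcont.tendsto q).comp hlim'
    rw [hq] at this
    refine this.congr fun t => ?_
    rw [Function.comp_apply, hg' t, separable_proj]

/-- A cell meeting `W^s(p) ∩ W^u(q)` is a connected component of it. -/
theorem connectedComponentIn_eq_cell {p q : Torus} (hp : separable m n p = -1)
    (hq : separable m n q = 1) {z : Torus}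
    (hz : z ∈ stableManifold (separable m n) p ∩ unstableManifold (separable m n) q)
    {e : CellIndex m n} (he : z ∈ cell hm hn e) :
    connectedComponentIn (stableManifold (separable m n) p ∩ unstableManifold (separable m n) q) z =
      cell hm hn e := by
  obtain ⟨p', q', -, -, hlim⟩ := exists_limits_cell hm hn e
  obtain rfl : p' = p := by
    obtain ⟨γ, hγ, h0, h⟩ := hz.1
    exact tendsto_nhds_unique (hlim γ hγ (h0 ▸ he)).1 h
  obtain rfl : q' = q := by
    obtain ⟨γ, hγ, h0, h⟩ := hz.2
    exact tendsto_nhds_unique (hlim γ hγ (h0 ▸ he)).2 h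
  refine Subset.antisymm ?_ ((isPreconnected_cell hm hn e).subset_connectedComponentIn he ?_)
  -- The intersection avoids the separatrices, hence is covered by disjoint open cells; a connected
  -- set meeting the cell e lies inside it.
  · refine isPreconnected_connectedComponentIn.subset_left_of_subset_union (isOpen_cell hm hn e)
      (isOpen_iUnion fun e' : {e' // e' ≠ e} => isOpen_cell hm hn e'.1) ?_ ?_
      ⟨z, mem_connectedComponentIn hz, he⟩
    · exact disjoint_iUnion_right.2 fun e' => disjoint_cell hm hn e'.2.symm
    · intro w hw
      have hw' := connectedComponentIn_subset _ _ hw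
      obtain ⟨x, rfl⟩ := proj_surjective w
      obtain ⟨e', he'⟩ := exists_mem_cell hm hn
        (abs_ne_of_mem_stable_inter_unstable hm hn hp hq hw')
      by_cases hee : e' = e
      · exact Or.inl (hee ▸ he')
      · exact Or.inr (mem_iUnion.2 ⟨⟨e', hee⟩, he'⟩)
  -- Conversely, the whole cell lies in the intersection, since all its trajectories share the same
  -- two limits.
  · intro w hw
    obtain ⟨γ, hγ, h0⟩ := exists_trajectory hm hn w
    obtain ⟨h1, h2⟩ := hlim γ hγ (h0 ▸ hw)
    exact ⟨⟨γ, hγ, h0, h1⟩, γ, hγ, h0, h2⟩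

theorem isNeumannDomain_separable_iff {Ω : Set Torus} :
    IsNeumannDomain (separable m n) Ω ↔ ∃ e, cell hm hn e = Ω := by
  constructor
  · rintro ⟨p, q, hp, hq, z, hz, rfl⟩
    have hp' := separable_eq_neg_one_of_isLocalMin hm hn hp
    have hq' := separable_eq_one_of_isLocalMax hm hn hq
    obtain ⟨x, rfl⟩ := proj_surjective z
    obtain ⟨e, he⟩ := exists_mem_cell hm hn
      (abs_ne_of_mem_stable_inter_unstable hm hn hp' hq' hz)
    exact ⟨e, (connectedComponentIn_eq_cell hm hn hp' hq' hz he).symm⟩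
  · rintro ⟨e, rfl⟩
    obtain ⟨p, q, hp, hq, hlim⟩ := exists_limits_cell hm hn e
    obtain ⟨z, hz⟩ := cell_nonempty hm hn e
    obtain ⟨γ, hγ, h0⟩ := exists_trajectory hm hn z
    obtain ⟨h1, h2⟩ := hlim γ hγ (h0 ▸ hz)
    have hz' : z ∈ stableManifold (separable m n) p ∩ unstableManifold (separable m n) q :=
      ⟨⟨γ, hγ, h0, h1⟩, γ, hγ, h0, h2⟩
    exact ⟨p, q, isLocalMin_of_separable_eq hp, isLocalMax_of_separable_eq hq, z, hz',
      (connectedComponentIn_eq_cell hm hn hp hq hz' hz).symm⟩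

-- The cells are nonempty and pairwise disjoint, hence distinct: 2m·2n from each of the two charts.
include hm hn in
theorem neumannCount_separable : neumannCount (separable m n) = 8 * m * n := by
  have hinj : Function.Injective (cell hm hn) := by
    intro e e' h
    by_contra hne
    have := disjoint_cell hm hn hne
    rw [h, disjoint_self] at this
    exact (cell_nonempty hm hn e').ne_empty this
  have hset : {Ω : Set Torus | IsNeumannDomain (separable m n) Ω} = range (cell hm hn) := by
    ext Ω
    exact isNeumannDomain_separable_iff hm hn
  rw [neumannCount, hset, ← image_univ, ncard_image_of_injective _ hinj, ncard_univ]
  simp only [Nat.card_eq_fintype_card, Fintype.card_sum, Fintype.card_prod, Fintype.card_fin]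
  ring

end count

end NeumannTorus

/-! ### Fourier analysis of the eigenspaces -/

namespace NeumannTorus

open Filter Set MeasureTheory UnitAddTorus
open scoped Topology ContDiff Laplacian

/-! ### Partial derivatives on the torus -/

section deriv

/-- The standard basis vectors of the plane. -/
noncomputable abbrev basisVec (i : Fin 2) : Plane := EuclideanSpace.basisFun (Fin 2) ℝ i

/-- Smooth functions on the torus. -/
def IsSmooth (F : Torus → ℂ) : Prop := ContDiff ℝ ∞ fun x => F (proj x)

/-- The partial derivative of a function on the torus. -/
noncomputable def partialDeriv (i : Fin 2) (F : Torus → ℂ) : Torus → ℂ := fun z =>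
  fderiv ℝ (fun x => F (proj x)) (Function.surjInv proj_surjective z) (basisVec i)

theorem proj_add_eq_of_proj_eq {x y : Plane} (h : proj x = proj y) (w : Plane) :
    proj (w + (x - y)) = proj w := by
  obtain ⟨a, b, ha, hb⟩ := proj_eq_proj_iff.1 h
  exact proj_eq_proj_iff.2 ⟨a, b, by simp [ha], by simp [hb]⟩

theorem proj_add (x y : Plane) : proj (x + y) = proj x + proj y := by
  funext i
  simp [proj]

/-- The lift is invariant under translation by x - y. Consequently the preimage chosen in
`partialDeriv` does not matter. -/
theorem fderiv_comp_proj_eq (F : Torus → ℂ) {x y : Plane} (h : proj x = proj y) :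
    fderiv ℝ (fun x => F (proj x)) x = fderiv ℝ (fun x => F (proj x)) y := by
  have := fderiv_comp_add_right (𝕜 := ℝ) (f := fun x => F (proj x)) (x := y) (x - y)
  simp only [proj_add_eq_of_proj_eq h, add_sub_cancel] at this
  exact this.symm

theorem partialDeriv_proj (i : Fin 2) (F : Torus → ℂ) (x : Plane) :
    partialDeriv i F (proj x) = fderiv ℝ (fun x => F (proj x)) x (basisVec i) := by
  rw [partialDeriv, fderiv_comp_proj_eq F (Function.surjInv_eq proj_surjective (proj x))]

variable {F G : Torus → ℂ}

theorem IsSmooth.differentiable (hF : IsSmooth F) : Differentiable ℝ fun x => F (proj x) :=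
  ContDiff.differentiable hF (by simp)

theorem IsSmooth.continuous (hF : IsSmooth F) : Continuous F :=
  isQuotientMap_proj.continuous_iff.2 (ContDiff.continuous hF)

theorem IsSmooth.mul (hF : IsSmooth F) (hG : IsSmooth G) : IsSmooth (F * G) :=
  ContDiff.mul hF hG

theorem IsSmooth.partialDeriv (hF : IsSmooth F) (i : Fin 2) : IsSmooth (partialDeriv i F) := by
  unfold IsSmooth
  simp only [partialDeriv_proj]
  exact (ContDiff.fderiv_right hF (m := ∞) (by simp)).clm_apply contDiff_const

theorem partialDeriv_mul (hF : IsSmooth F) (hG : IsSmooth G) (i : Fin 2) :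
    partialDeriv i (F * G) = partialDeriv i F * G + F * partialDeriv i G := by
  funext z
  obtain ⟨x, rfl⟩ := proj_surjective z
  simp only [Pi.add_apply, Pi.mul_apply, partialDeriv_proj]
  rw [fderiv_fun_mul (hF.differentiable x) (hG.differentiable x)]
  simp
  ring

theorem laplacian_eq_sum_partialDeriv (hF : IsSmooth F) (x : Plane) :
    Δ (fun y : Plane => F (proj y)) x = ∑ i, partialDeriv i (partialDeriv i F) (proj x) := by
  rw [InnerProductSpace.laplacian_eq_iteratedFDeriv_orthonormalBasis _
    (EuclideanSpace.basisFun (Fin 2) ℝ)]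
  refine Finset.sum_congr rfl fun i _ => ?_
  rw [iteratedFDeriv_two_apply, partialDeriv_proj]
  simp only [partialDeriv_proj]
  have hd : Differentiable ℝ (fderiv ℝ fun x => F (proj x)) :=
    (ContDiff.fderiv_right hF (m := ∞) (by simp)).differentiable (by simp)
  rw [fderiv_clm_apply (hd x) (differentiableAt_const _)]
  simp

end deriv

/-! ### Integration by parts -/

section integral

attribute [local instance] instMeasureSpaceUnitAddCircle
  instIsAddHaarMeasureUnitAddCircleVolume instIsProbabilityMeasureUnitAddCircleVolume

variable {F G : Torus → ℂ}

theorem integrable_of_continuous (hF : Continuous F) : Integrable F :=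
  hF.integrable_of_hasCompactSupport (.of_compactSpace F)

/-- By invariance of Haar measure, t ↦ ∫ F(z + t·eᵢ) is constant; differentiating under the integral
sign at t = 0 gives the claim. The derivative is dominated by its maximum on the compact torus. -/
theorem integral_partialDeriv (hF : IsSmooth F) (i : Fin 2) : ∫ z, partialDeriv i F z = 0 := by
  have hD := (hF.partialDeriv i).continuous
  obtain ⟨C, hC⟩ := isCompact_univ.exists_bound_of_continuousOn hD.continuousOn
  have hcont : ∀ t : ℝ, Continuous fun z : Torus => z + proj (t • basisVec i) := fun t => by
    fun_prop
  have hderiv : ∀ (z : Torus) (t : ℝ), HasDerivAt (fun t : ℝ => F (z + proj (t • basisVec i)))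
      (partialDeriv i F (z + proj (t • basisVec i))) t := by
    intro z t
    obtain ⟨x, rfl⟩ := proj_surjective z
    simp only [← proj_add, partialDeriv_proj]
    have h1 : HasDerivAt (fun t : ℝ => x + t • basisVec i) (basisVec i) t := by
      simpa using ((hasDerivAt_id t).smul_const (basisVec i)).const_add x
    exact (hF.differentiable _).hasFDerivAt.comp_hasDerivAt t h1
  have key := (hasDerivAt_integral_of_dominated_loc_of_deriv_le (μ := (volume : Measure Torus))
    (F := fun (t : ℝ) z => F (z + proj (t • basisVec i)))
    (F' := fun (t : ℝ) z => partialDeriv i F (z + proj (t • basisVec i)))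
    (bound := fun _ => C) (x₀ := (0 : ℝ)) (s := univ) univ_mem
    (.of_forall fun t => (hF.continuous.comp (hcont t)).aestronglyMeasurable)
    (integrable_of_continuous (hF.continuous.comp (hcont 0)))
    (hD.comp (hcont 0)).aestronglyMeasurable
    (.of_forall fun z t _ => hC _ (mem_univ _)) (integrable_const C)
    (.of_forall fun z t _ => hderiv z t)).2
  simp only [integral_add_right_eq_self] at key
  exact (key.unique (hasDerivAt_const _ _)).symm ▸ rfl

theorem integral_partialDeriv_mul (hF : IsSmooth F) (hG : IsSmooth G) (i : Fin 2) :
    ∫ z, partialDeriv i F z * G z = -∫ z, F z * partialDeriv i G z := by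
  have h := integral_partialDeriv (hF.mul hG) i
  rw [partialDeriv_mul hF hG] at h
  have h1 : Integrable fun z => partialDeriv i F z * G z :=
    integrable_of_continuous ((hF.partialDeriv i).continuous.mul hG.continuous)
  have h2 : Integrable fun z => F z * partialDeriv i G z :=
    integrable_of_continuous (hF.continuous.mul (hG.partialDeriv i).continuous)
  have h3 := integral_add h1 h2
  rw [← add_eq_zero_iff_eq_neg, ← h3, ← h]
  rfl

/-! ### Characters -/

theorem mFourier_proj (k : Fin 2 → ℤ) (x : Plane) :
    mFourier k (proj x) = Complex.exp (2 * Real.pi * Complex.I * (k 0 * x 0 + k 1 * x 1)) := by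
  simp only [mFourier, ContinuousMap.coe_mk, Fin.prod_univ_two, proj, fourier_coe_apply,
    ← Complex.exp_add]
  congr 1
  push_cast
  ring

theorem hasFDerivAt_mFourier_proj (k : Fin 2 → ℤ) (x : Plane) :
    HasFDerivAt (fun x => mFourier k (proj x))
      (mFourier k (proj x) • ((2 * Real.pi * Complex.I) •
        (((k 0 : ℂ) • Complex.ofRealCLM ∘L EuclideanSpace.proj (𝕜 := ℝ) (0 : Fin 2)) +
          (k 1 : ℂ) • Complex.ofRealCLM ∘L EuclideanSpace.proj (𝕜 := ℝ) (1 : Fin 2)))) x := by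
  simp only [mFourier_proj]
  have h : ∀ i : Fin 2, HasFDerivAt (fun x : Plane => (x i : ℂ))
      (Complex.ofRealCLM ∘L EuclideanSpace.proj (𝕜 := ℝ) i) x := fun i =>
    (Complex.ofRealCLM ∘L EuclideanSpace.proj (𝕜 := ℝ) i).hasFDerivAt
  exact ((((h 0).const_mul _).add ((h 1).const_mul _)).const_mul _).cexp

theorem isSmooth_mFourier (k : Fin 2 → ℤ) : IsSmooth (mFourier k) := by
  unfold IsSmooth
  simp only [mFourier_proj]
  have h : ∀ i : Fin 2, ContDiff ℝ ∞ (fun x : Plane => (x i : ℂ)) := fun i =>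
    (Complex.ofRealCLM ∘L EuclideanSpace.proj (𝕜 := ℝ) i).contDiff
  exact (contDiff_const.mul ((contDiff_const.mul (h 0)).add (contDiff_const.mul (h 1)))).cexp

theorem partialDeriv_mFourier (k : Fin 2 → ℤ) (i : Fin 2) :
    partialDeriv i (mFourier k) = (2 * Real.pi * Complex.I * k i) • ⇑(mFourier k) := by
  funext z
  obtain ⟨x, rfl⟩ := proj_surjective z
  rw [partialDeriv_proj, (hasFDerivAt_mFourier_proj k x).fderiv]
  fin_cases i
  · simp; ring
  · simp; ring

theorem mFourierCoeff_partialDeriv (hF : IsSmooth F) (i : Fin 2) (k : Fin 2 → ℤ) :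
    mFourierCoeff (partialDeriv i F) k = (2 * Real.pi * Complex.I * k i) * mFourierCoeff F k := by
  have h := integral_partialDeriv_mul hF (isSmooth_mFourier (-k)) i
  simp only [mFourierCoeff, smul_eq_mul]
  rw [← integral_const_mul]
  calc ∫ z, mFourier (-k) z * partialDeriv i F z = ∫ z, partialDeriv i F z * mFourier (-k) z := by
        simp only [mul_comm]
    _ = _ := by
      rw [h, ← integral_neg, partialDeriv_mFourier]
      refine integral_congr_ae (.of_forall fun z => ?_)
      simp
      ring

/-- The eigenvalue of the character with frequency `k`. -/
noncomputable def latticeEigenvalue (k : Fin 2 → ℤ) : ℝ :=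
  4 * Real.pi ^ 2 * ((k 0 : ℝ) ^ 2 + (k 1 : ℝ) ^ 2)

theorem mFourier_mem_eigenspace (k : Fin 2 → ℤ) :
    ⇑(mFourier k) ∈ eigenspace (latticeEigenvalue k) := by
  refine ⟨isSmooth_mFourier k, fun x => ?_⟩
  rw [laplacian_eq_sum_partialDeriv (isSmooth_mFourier k)]
  have h : ∀ i, partialDeriv i (partialDeriv i (mFourier k)) (proj x) =
      (2 * Real.pi * Complex.I * k i) ^ 2 * mFourier k (proj x) := by
    intro i
    rw [partialDeriv_proj, partialDeriv_mFourier]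
    have h2 := partialDeriv_proj i (mFourier k) x
    rw [partialDeriv_mFourier] at h2
    have h3 := fderiv_const_smul ((isSmooth_mFourier k).differentiable x)
      (2 * Real.pi * Complex.I * k i : ℂ)
    change (fderiv ℝ ((2 * Real.pi * Complex.I * k i : ℂ) • fun x => mFourier k (proj x)) x)
      (basisVec i) = _
    rw [h3, _root_.smul_apply, ← h2]
    simp only [Pi.smul_apply, smul_eq_mul]
    ring
  rw [Fin.sum_univ_two, h, h, latticeEigenvalue]
  push_cast
  simp only [mul_pow, Complex.I_sq]
  ring

/-- Taking the k-th Fourier coefficient of the eigenvalue equation gives (4π²|k|² - μ)·F̂(k) = 0. -/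
theorem mFourierCoeff_eq_zero {μ : ℝ} (hF : F ∈ eigenspace μ) {k : Fin 2 → ℤ}
    (hk : latticeEigenvalue k ≠ μ) : mFourierCoeff F k = 0 := by
  obtain ⟨hF, hΔ⟩ := hF
  have hF : IsSmooth F := hF
  have h1 : ∀ z, ∑ i, partialDeriv i (partialDeriv i F) z = -(μ : ℂ) * F z := by
    intro z
    obtain ⟨x, rfl⟩ := proj_surjective z
    rw [← laplacian_eq_sum_partialDeriv hF, neg_mul, ← hΔ, neg_neg]
  have hint : ∀ i, Integrable fun z => mFourier (-k) z • partialDeriv i (partialDeriv i F) z :=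
    fun i => integrable_of_continuous
      ((mFourier (-k)).continuous.smul ((hF.partialDeriv i).partialDeriv i).continuous)
  have h2 : ∑ i, mFourierCoeff (partialDeriv i (partialDeriv i F)) k =
      -(μ : ℂ) * mFourierCoeff F k := by
    simp only [mFourierCoeff]
    rw [← integral_finsetSum _ fun i _ => hint i, ← integral_const_mul]
    refine integral_congr_ae (.of_forall fun z => ?_)
    simp only [smul_eq_mul]
    rw [← Finset.mul_sum, h1]
    ring
  simp only [mFourierCoeff_partialDeriv (hF.partialDeriv _), mFourierCoeff_partialDeriv hF,
    Fin.sum_univ_two] at h2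
  have h3 : ((latticeEigenvalue k : ℝ) - (μ : ℝ) : ℂ) * mFourierCoeff F k = 0 := by
    rw [latticeEigenvalue]
    push_cast
    linear_combination -h2 + (4 * Real.pi ^ 2 * (k 0 ^ 2 + k 1 ^ 2) * mFourierCoeff F k) *
      Complex.I_sq
  exact (mul_eq_zero.1 h3).resolve_left fun h => hk (by exact_mod_cast sub_eq_zero.1 h)

theorem linearIndependent_mFourier :
    LinearIndependent ℂ fun k : Fin 2 → ℤ => (⇑(mFourier k) : Torus → ℂ) := by
  have h1 : LinearIndependent ℂ (mFourier (d := Fin 2)) :=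
    LinearIndependent.of_comp
      (ContinuousMap.toLp (E := ℂ) 2 (volume : Measure Torus) ℂ).toLinearMap
      (orthonormal_mFourier (d := Fin 2)).linearIndependent
  refine h1.map' (ContinuousMap.coeFnLinearMap ℂ) ?_
  rw [LinearMap.ker_eq_bot]
  exact DFunLike.coe_injective

theorem finite_latticeEigenvalue_lt (E : ℝ) : {k | latticeEigenvalue k < E}.Finite := by
  refine (finite_Icc (fun _ : Fin 2 => -⌈|E|⌉) (fun _ => ⌈|E|⌉)).subset fun k hk => ?_
  have hpi : 1 ≤ 4 * Real.pi ^ 2 := by nlinarith [Real.pi_gt_three]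
  have hE : E ≤ ⌈|E|⌉ := (le_abs_self E).trans (Int.le_ceil _)
  have hk : latticeEigenvalue k < E := hk
  rw [latticeEigenvalue] at hk
  have h : ∀ i, |k i| ≤ ⌈|E|⌉ := by
    intro i
    have h1 : (k i : ℝ) ^ 2 ≤ (k 0 : ℝ) ^ 2 + (k 1 : ℝ) ^ 2 := by
      fin_cases i
      · exact le_add_of_nonneg_right (sq_nonneg _)
      · exact le_add_of_nonneg_left (sq_nonneg _)
    have h2 : (k i : ℝ) ^ 2 ≤ ⌈|E|⌉ := by nlinarith [sq_nonneg (k 0 : ℝ), sq_nonneg (k 1 : ℝ)]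
    have h3 : k i ^ 2 ≤ ⌈|E|⌉ := by exact_mod_cast h2
    refine le_trans ?_ h3
    rw [← sq_abs]
    exact Int.le_self_sq _
  exact ⟨fun i => (abs_le.1 (h i)).1, fun i => (abs_le.1 (h i)).2⟩

theorem finite_latticeEigenvalue_eq (μ : ℝ) : {k | latticeEigenvalue k = μ}.Finite :=
  (finite_latticeEigenvalue_lt (μ + 1)).subset fun k (hk : latticeEigenvalue k = μ) => by
    change latticeEigenvalue k < μ + 1
    linarith

/-- Only the finitely many k on the circle 4π²|k|² = μ contribute to the Fourier series of an
eigenfunction, so the series is a finite sum and holds pointwise. The corresponding characters are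
then a basis. -/
theorem finrank_eigenspace (μ : ℝ) :
    Module.finrank ℂ (eigenspace μ) = {k | latticeEigenvalue k = μ}.ncard := by
  have hfin := finite_latticeEigenvalue_eq μ
  have hspan : eigenspace μ = Submodule.span ℂ
      (range fun k : {k | latticeEigenvalue k = μ} => (⇑(mFourier k.1) : Torus → ℂ)) := by
    refine le_antisymm (fun F hF => ?_) (Submodule.span_le.2 ?_)
    · have hsmooth : IsSmooth F := hF.1
      set f : C(Torus, ℂ) := ⟨F, hsmooth.continuous⟩
      have hzero : ∀ k ∉ hfin.toFinset, mFourierCoeff F k = 0 := fun k hk =>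
        mFourierCoeff_eq_zero hF fun h => hk (hfin.mem_toFinset.2 h)
      have hsum : Summable (mFourierCoeff f) := summable_of_ne_finset_zero hzero
      have heq : F = ∑ k ∈ hfin.toFinset, mFourierCoeff F k • ⇑(mFourier k) := by
        funext z
        rw [Finset.sum_apply]
        refine (hasSum_mFourier_series_apply_of_summable hsum z).unique
          (hasSum_sum_of_ne_finset_zero fun k hk => ?_)
        change mFourierCoeff F k • _ = _
        rw [hzero k hk, zero_smul]
      rw [heq]
      exact Submodule.sum_mem _ fun k hk => Submodule.smul_mem _ _
        (Submodule.subset_span ⟨⟨k, hfin.mem_toFinset.1 hk⟩, rfl⟩)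
    · rintro _ ⟨⟨k, rfl⟩, rfl⟩
      exact mFourier_mem_eigenspace k
  have := hfin.fintype
  rw [hspan, finrank_span_eq_card, ← Nat.card_eq_fintype_card, Nat.card_coe_set_eq]
  exact linearIndependent_mFourier.comp _ Subtype.val_injective

theorem spectralPosition_eq (E : ℝ) :
    spectralPosition E = {k | latticeEigenvalue k < E}.ncard := by
  classical
  have hfin := finite_latticeEigenvalue_lt E
  rw [spectralPosition, ncard_eq_toFinset_card _ hfin,
    Finset.card_eq_sum_card_image latticeEigenvalue]
  simp only [finsum_eq_if, finrank_eigenspace]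
  -- A `finsum` with infinite support would be 0 by convention; here the support lies in the finite
  -- set of lattice eigenvalues below E.
  rw [finsum_eq_sum_of_support_subset (s := hfin.toFinset.image latticeEigenvalue)]
  · refine Finset.sum_congr rfl fun μ hμ => ?_
    obtain ⟨k, hk, rfl⟩ := Finset.mem_image.1 hμ
    have hkE : latticeEigenvalue k < E := hfin.mem_toFinset.1 hk
    rw [if_pos hkE, ← ncard_coe_finset]
    congr 1
    ext l
    simp only [mem_ofPred_eq, Finset.coe_filter, hfin.mem_toFinset]
    exact ⟨fun h => ⟨h ▸ hkE, h⟩, fun h => h.2⟩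
  · intro μ hμ
    rw [Function.mem_support] at hμ
    split_ifs at hμ with hE
    · obtain ⟨k, hk⟩ := nonempty_of_ncard_ne_zero hμ
      have hk : latticeEigenvalue k = μ := hk
      exact Finset.mem_coe.2 (Finset.mem_image.2 ⟨k, hfin.mem_toFinset.2 (hk.trans_lt hE), hk⟩)
    · exact absurd rfl hμ

end integral

end NeumannTorus

/-! ### Lattice-point asymptotics and areas -/

namespace NeumannTorus

open Real Filter Set MeasureTheory
open scoped Topology

/-! ### Counting lattice points -/

/-- The last hypothesis makes the dilates of S nested, which gives the limit along real scales R and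
not only along integers. -/
theorem tendsto_ncard_lattice_div {S : Set (ℝ × ℝ)} (hb : Bornology.IsBounded S)
    (hm : MeasurableSet S) (hf : volume (frontier S) = 0)
    (hs : ∀ p ∈ S, ∀ x : ℝ, 0 < x → x ≤ 1 → x • p ∈ S) :
    Tendsto (fun R : ℝ => ({k : Fin 2 → ℤ | (R⁻¹ * k 0, R⁻¹ * k 1) ∈ S}.ncard : ℝ) / R ^ 2) atTop
      (𝓝 (volume.real S)) := by
  set φ : (Fin 2 → ℝ) ≃ₜ ℝ × ℝ := Homeomorph.finTwoArrow
  have hvol : ∀ T : Set (ℝ × ℝ), volume (φ ⁻¹' T) = volume T := fun T =>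
    (volume_preserving_finTwoArrow ℝ).measure_preimage_equiv T
  have key := tendsto_card_div_pow_atTop_volume' (φ ⁻¹' S) ?_ (φ.continuous.measurable hm) ?_ ?_
  · rw [Measure.real, hvol] at key
    refine key.congr' ?_
    filter_upwards [eventually_gt_atTop 0] with R hR
    rw [Fintype.card_fin, Nat.card_coe_set_eq]
    congr 2
    rw [← ncard_image_of_injective (f := fun (k : Fin 2 → ℤ) i => R⁻¹ * (k i : ℝ))]
    · congr 1
      ext p
      simp only [mem_inter_iff, mem_preimage, mem_image, mem_ofPred_eq,
        mem_smul_set_iff_inv_smul_mem₀ (inv_ne_zero hR.ne'), inv_inv, SetLike.mem_coe,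
        Module.Basis.mem_span_iff_repr_mem, Pi.basisFun_repr]
      constructor
      · rintro ⟨h1, h2⟩
        choose k hk using h2
        have hk' : ∀ i, p i = R⁻¹ * k i := fun i => by
          have := hk i
          simp only [algebraMap_int_eq, eq_intCast, Pi.smul_apply, smul_eq_mul] at this
          rw [this, inv_mul_cancel_left₀ hR.ne']
        refine ⟨k, ?_, funext fun i => (hk' i).symm⟩
        rw [← hk' 0, ← hk' 1]
        exact h1
      · rintro ⟨k, hk, rfl⟩
        exact ⟨hk, fun i => ⟨k i, by simp [hR.ne']⟩⟩
    · intro k l hkl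
      funext i
      have := congrFun hkl i
      simpa [hR.ne'] using this
  · obtain ⟨C, hC⟩ := hb.exists_norm_le
    refine isBounded_iff_forall_norm_le.2 ⟨max C 0, fun p hp => ?_⟩
    refine (pi_norm_le_iff_of_nonneg (le_max_right _ _)).2 (Fin.forall_fin_two.2 ⟨?_, ?_⟩)
    · exact (norm_fst_le (φ p)).trans ((hC _ hp).trans (le_max_left _ _))
    · exact (norm_snd_le (φ p)).trans ((hC _ hp).trans (le_max_left _ _))
  · rw [← φ.preimage_frontier, hvol, hf]
  · rintro x y hx hxy _ ⟨p, hp, rfl⟩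
    have hy : 0 < y := hx.trans_le hxy
    refine ⟨(x / y) • p, ?_, ?_⟩
    · exact hs _ hp _ (div_pos hx hy) ((div_le_one hy).2 hxy)
    · simp only [smul_smul]
      rw [mul_div_cancel₀ _ hy.ne']

/-! ### Areas in polar coordinates -/

/-- When S is a product of conditions on r and on θ, the polar integral factors by Tonelli. -/
theorem volume_eq_lintegral_mul_of_polar {S : Set (ℝ × ℝ)} (hS : MeasurableSet S) {ρ Θ : Set ℝ}
    (hρ : MeasurableSet ρ) (hΘ : MeasurableSet Θ)
    (h : ∀ r θ, 0 < r → θ ∈ Ioo (-π) π → ((r * cos θ, r * sin θ) ∈ S ↔ r ∈ ρ ∧ θ ∈ Θ)) :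
    volume S = (∫⁻ r in Ioi 0, ENNReal.ofReal r * ρ.indicator 1 r) *
      volume (Θ ∩ Ioo (-π) π) := by
  have h1 : volume S = ∫⁻ p, S.indicator 1 p := by rw [lintegral_indicator_one hS]
  rw [h1, ← lintegral_comp_polarCoord_symm]
  have htarget : polarCoord.target = Ioi (0 : ℝ) ×ˢ Ioo (-π) π := rfl
  rw [htarget]
  have h2 : ∫⁻ p in Ioi (0 : ℝ) ×ˢ Ioo (-π) π,
      ENNReal.ofReal p.1 • S.indicator 1 (polarCoord.symm p) =
      ∫⁻ p in Ioi (0 : ℝ) ×ˢ Ioo (-π) π,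
        (ENNReal.ofReal p.1 * ρ.indicator 1 p.1) * Θ.indicator 1 p.2 := by
    refine setLIntegral_congr_fun (measurableSet_Ioi.prod measurableSet_Ioo) fun p hp => ?_
    have := h p.1 p.2 hp.1 hp.2
    simp only [polarCoord_symm_apply, smul_eq_mul, mul_assoc]
    congr 1
    by_cases h3 : p.1 ∈ ρ <;> by_cases h4 : p.2 ∈ Θ <;> simp [indicator, this, h3, h4]
  rw [h2, Measure.volume_eq_prod, ← Measure.prod_restrict,
    lintegral_prod_mul (f := fun r => ENNReal.ofReal r * ρ.indicator 1 r) (g := Θ.indicator 1)]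
  · rw [lintegral_indicator_one hΘ, Measure.restrict_apply hΘ]
  · exact (ENNReal.measurable_ofReal.mul (measurable_one.indicator hρ)).aemeasurable
  · exact (measurable_one.indicator hΘ).aemeasurable

theorem lintegral_radius : ∫⁻ r in Ioi (0 : ℝ), ENNReal.ofReal r * (Iio 1).indicator 1 r =
    ENNReal.ofReal (1 / 2) := by
  have h1 : ∫⁻ r in Ioi (0 : ℝ), ENNReal.ofReal r * (Iio 1).indicator 1 r =
      ∫⁻ r in Ioo (0 : ℝ) 1, ENNReal.ofReal r := by
    have : (fun r : ℝ => ENNReal.ofReal r * (Iio 1).indicator 1 r) =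
        (Iio (1 : ℝ)).indicator fun r => ENNReal.ofReal r := by
      funext r
      by_cases hr : r < 1 <;> simp [indicator, hr]
    rw [this, lintegral_indicator measurableSet_Iio, Measure.restrict_restrict measurableSet_Iio,
      inter_comm, Ioi_inter_Iio]
  rw [h1, ← ofReal_integral_eq_lintegral_ofReal]
  · rw [← integral_Ioc_eq_integral_Ioo, ← intervalIntegral.integral_of_le zero_le_one, integral_id]
    norm_num
  · exact (continuous_id.integrableOn_Icc (a := (0 : ℝ)) (b := 1)).mono_set Ioo_subset_Icc_self
  · exact (ae_restrict_mem measurableSet_Ioo).mono fun r hr => hr.1.le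

/-! ### The disc -/

/-- The open unit disc. -/
def disc : Set (ℝ × ℝ) := {p | p.1 ^ 2 + p.2 ^ 2 < 1}

/-- The part of the open unit disc in the open first quadrant. -/
def quarterDisc : Set (ℝ × ℝ) := {p | 0 < p.1 ∧ 0 < p.2 ∧ p.1 ^ 2 + p.2 ^ 2 < 1}

theorem isOpen_disc : IsOpen disc := by
  have h : Continuous fun p : ℝ × ℝ => p.1 ^ 2 + p.2 ^ 2 := by fun_prop
  exact isOpen_lt h continuous_const

theorem isBounded_disc : Bornology.IsBounded disc := by
  refine isBounded_iff_forall_norm_le.2 ⟨1, fun p (hp : p.1 ^ 2 + p.2 ^ 2 < 1) => ?_⟩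
  refine max_le ?_ ?_
  · rw [norm_eq_abs, ← sq_le_one_iff_abs_le_one]; nlinarith [sq_nonneg p.2]
  · rw [norm_eq_abs, ← sq_le_one_iff_abs_le_one]; nlinarith [sq_nonneg p.1]

theorem convex_disc : Convex ℝ disc := by
  intro p hp q hq a b ha hb hab
  have hp : p.1 ^ 2 + p.2 ^ 2 < 1 := hp
  have hq : q.1 ^ 2 + q.2 ^ 2 < 1 := hq
  have key : ∀ x y : ℝ, (a * x + b * y) ^ 2 ≤ a * x ^ 2 + b * y ^ 2 := fun x y => by
    have h : a * x ^ 2 + b * y ^ 2 - (a * x + b * y) ^ 2 = a * b * (x - y) ^ 2 := by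
      obtain rfl : b = 1 - a := by linarith
      ring
    have : 0 ≤ a * b * (x - y) ^ 2 := by positivity
    linarith
  change (a * p.1 + b * q.1) ^ 2 + (a * p.2 + b * q.2) ^ 2 < 1
  have h1 := key p.1 q.1
  have h2 := key p.2 q.2
  have h3 : a * (p.1 ^ 2 + p.2 ^ 2) + b * (q.1 ^ 2 + q.2 ^ 2) < 1 := by
    rcases ha.eq_or_lt with rfl | ha
    · obtain rfl : b = 1 := by linarith
      linarith
    · nlinarith [mul_lt_mul_of_pos_left hp ha, mul_le_mul_of_nonneg_left hq.le hb]
  linarith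

theorem quarterDisc_eq : quarterDisc = ({p | 0 < p.1} ∩ {p | 0 < p.2}) ∩ disc := by
  ext p
  exact (and_assoc (a := 0 < p.1)).symm

theorem convex_quarterDisc : Convex ℝ quarterDisc := by
  rw [quarterDisc_eq]
  refine Convex.inter (Convex.inter ?_ ?_) convex_disc
  · exact convex_halfSpace_gt (LinearMap.fst ℝ ℝ ℝ).isLinear 0
  · exact convex_halfSpace_gt (LinearMap.snd ℝ ℝ ℝ).isLinear 0

theorem isOpen_quarterDisc : IsOpen quarterDisc := by
  rw [quarterDisc_eq]
  exact ((isOpen_lt continuous_const continuous_fst).inter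
    (isOpen_lt continuous_const continuous_snd)).inter isOpen_disc

theorem polar_sq_add_sq (r θ : ℝ) : (r * cos θ) ^ 2 + (r * sin θ) ^ 2 = r ^ 2 := by
  linear_combination r ^ 2 * sin_sq_add_cos_sq θ

theorem volume_disc : volume.real disc = π := by
  rw [Measure.real, volume_eq_lintegral_mul_of_polar isOpen_disc.measurableSet
    (ρ := Iio 1) (Θ := univ) measurableSet_Iio .univ, lintegral_radius, univ_inter,
    Real.volume_Ioo, ← ENNReal.ofReal_mul (by norm_num), ENNReal.toReal_ofReal]
  · ring
  · linarith [pi_pos]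
  · intro r θ hr hθ
    change (r * cos θ) ^ 2 + (r * sin θ) ^ 2 < 1 ↔ _
    rw [polar_sq_add_sq, sq_lt_one_iff₀ hr.le]
    simp

/-! ### The sectors -/

/-- The points of the quarter disc at which the normalized Neumann count is less than `c`. -/
def sector (c : ℝ) : Set (ℝ × ℝ) :=
  quarterDisc ∩ {p | 8 * (p.1 * p.2) < c * π * (p.1 ^ 2 + p.2 ^ 2)}

theorem isOpen_sector (c : ℝ) : IsOpen (sector c) := by
  have h1 : Continuous fun p : ℝ × ℝ => 8 * (p.1 * p.2) := by fun_prop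
  have h2 : Continuous fun p : ℝ × ℝ => c * π * (p.1 ^ 2 + p.2 ^ 2) := by fun_prop
  exact isOpen_quarterDisc.inter (isOpen_lt h1 h2)

theorem polar_eight_mul (r θ : ℝ) : 8 * (r * cos θ * (r * sin θ)) = r ^ 2 * (4 * sin (2 * θ)) := by
  rw [sin_two_mul]; ring

theorem volume_setOf_sin_eq (a : ℝ) : volume {θ : ℝ | sin (2 * θ) = a} = 0 := by
  refine Set.Countable.measure_zero ?_ _
  by_cases ha : ∃ θ₀, sin (2 * θ₀) = a
  · obtain ⟨θ₀, rfl⟩ := ha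
    refine ((countable_range fun k : ℤ => k * π + θ₀).union
      (countable_range fun k : ℤ => ((2 * k + 1) * π - 2 * θ₀) / 2)).mono fun θ hθ => ?_
    obtain ⟨k, hk | hk⟩ := Real.sin_eq_sin_iff.1 (Eq.symm hθ)
    · exact Or.inl ⟨k, by linarith⟩
    · exact Or.inr ⟨k, by linarith⟩
  · push Not at ha
    simp [ha]

/-- One part of the frontier bounds a convex set. The other lies on 8xy = cπ(x² + y²), which in
polar coordinates is sin 2θ = cπ/4 and involves only countably many angles. -/
theorem volume_frontier_sector (c : ℝ) : volume (frontier (sector c)) = 0 := by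
  have h1 : Continuous fun p : ℝ × ℝ => 8 * (p.1 * p.2) := by fun_prop
  have h2 : Continuous fun p : ℝ × ℝ => c * π * (p.1 ^ 2 + p.2 ^ 2) := by fun_prop
  refine measure_mono_null (frontier_inter_subset _ _) (measure_union_null ?_ ?_)
  · exact measure_mono_null inter_subset_left (convex_quarterDisc.addHaar_frontier volume)
  · refine measure_mono_null (inter_subset_right.trans (frontier_lt_subset_eq h1 h2)) ?_
    rw [volume_eq_lintegral_mul_of_polar (isClosed_eq h1 h2).measurableSet (ρ := univ)
      (Θ := {θ | sin (2 * θ) = c * π / 4}) .univ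
      (isClosed_eq (by fun_prop) continuous_const).measurableSet,
      measure_mono_null inter_subset_left (volume_setOf_sin_eq _), mul_zero]
    intro r θ hr hθ
    change 8 * (r * cos θ * (r * sin θ)) = c * π * ((r * cos θ) ^ 2 + (r * sin θ) ^ 2) ↔ _
    rw [polar_sq_add_sq, polar_eight_mul, mul_comm _ (r ^ 2), mul_right_inj' (by positivity)]
    simp only [mem_univ, mem_ofPred_eq, true_and]
    constructor <;> intro h <;> linarith

/-- The angles of the points in `sector c`. -/
def sectorAngles (c : ℝ) : Set ℝ := {θ | θ ∈ Ioo 0 (π / 2) ∧ 4 * sin (2 * θ) < c * π}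

theorem volume_sectorAngles {c : ℝ} (hc : 0 ≤ c) :
    volume (sectorAngles c) = ENNReal.ofReal (arcsin (π * c / 4)) := by
  rcases le_or_gt (π * c / 4) 1 with h1 | h1
  · set α := arcsin (π * c / 4) / 2 with hα
    have h0 : 0 ≤ π * c / 4 := by positivity
    have hα0 : 0 ≤ α := div_nonneg (arcsin_nonneg.2 h0) zero_le_two
    have hα1 : α ≤ π / 4 := by linarith [arcsin_le_pi_div_two (π * c / 4)]
    have hsin : 4 * sin (2 * α) = c * π := by
      rw [hα, mul_div_cancel₀ _ two_ne_zero, sin_arcsin (by linarith) h1]; ring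
    -- The reflection θ ↦ π/2 - θ preserves sin 2θ, which increases on [0, π/4]; so the small values
    -- occur near both axes, on two intervals of length α.
    have heq : sectorAngles c = Ioo 0 α ∪ Ioo (π / 2 - α) (π / 2) := by
      ext θ
      simp only [sectorAngles, mem_ofPred_eq, mem_union, mem_Ioo, ← hsin]
      have hlt : ∀ {x y : ℝ}, 0 ≤ x → x < y → y ≤ π / 4 → sin (2 * x) < sin (2 * y) := by
        intro x y hx hxy hy
        exact sin_lt_sin_of_lt_of_le_pi_div_two (by linarith [pi_pos]) (by linarith) (by linarith)
      have hle : ∀ {x y : ℝ}, 0 ≤ x → x ≤ y → y ≤ π / 4 → sin (2 * x) ≤ sin (2 * y) := by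
        intro x y hx hxy hy
        exact sin_le_sin_of_le_of_le_pi_div_two (by linarith [pi_pos]) (by linarith) (by linarith)
      have hrefl : sin (2 * (π / 2 - θ)) = sin (2 * θ) := by
        rw [mul_sub, mul_div_cancel₀ _ two_ne_zero, sin_pi_sub]
      constructor
      · rintro ⟨⟨h2, h3⟩, h4⟩
        by_contra! h5
        rcases le_total θ (π / 4) with h6 | h6
        · have h7 : α ≤ θ := h5.1 h2
          linarith [hle hα0 h7 h6]
        · have h7 : α ≤ π / 2 - θ := by
            by_contra! h8
            linarith [h5.2 (by linarith)]
          have := hle hα0 h7 (by linarith)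
          linarith
      · rintro (⟨h2, h3⟩ | ⟨h2, h3⟩)
        · exact ⟨⟨h2, by linarith⟩, by linarith [hlt h2.le h3 hα1]⟩
        · have := hlt (x := π / 2 - θ) (by linarith) (by linarith) hα1
          exact ⟨⟨by linarith, h3⟩, by linarith⟩
    rw [heq, measure_union _ measurableSet_Ioo, Real.volume_Ioo, Real.volume_Ioo,
      ← ENNReal.ofReal_add (by linarith) (by linarith)]
    · congr 1
      rw [hα]; ring
    · rw [disjoint_left]
      rintro θ ⟨h2, h3⟩ ⟨h4, h5⟩
      linarith
  · have heq : sectorAngles c = Ioo 0 (π / 2) := by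
      ext θ
      refine and_iff_left ?_
      linarith [sin_le_one (2 * θ)]
    rw [heq, Real.volume_Ioo, sub_zero, arcsin_of_one_le h1.le]

theorem measurableSet_sectorAngles (c : ℝ) : MeasurableSet (sectorAngles c) := by
  have h : Continuous fun θ : ℝ => 4 * sin (2 * θ) := by fun_prop
  exact (isOpen_Ioo.inter (isOpen_lt h continuous_const)).measurableSet

theorem volume_sector {c : ℝ} (hc : 0 ≤ c) : volume.real (sector c) = arcsin (π * c / 4) / 2 := by
  have harc : 0 ≤ arcsin (π * c / 4) := arcsin_nonneg.2 (by positivity)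
  have hsub : sectorAngles c ∩ Ioo (-π) π = sectorAngles c := by
    refine inter_eq_left.2 fun θ hθ => ?_
    exact ⟨by linarith [hθ.1.1, pi_pos], by linarith [hθ.1.2, pi_pos]⟩
  rw [Measure.real, volume_eq_lintegral_mul_of_polar (isOpen_sector c).measurableSet
    (ρ := Iio 1) (Θ := sectorAngles c) measurableSet_Iio (measurableSet_sectorAngles c),
    lintegral_radius, hsub, volume_sectorAngles hc, ← ENNReal.ofReal_mul (by norm_num),
    ENNReal.toReal_ofReal (by positivity)]
  · ring
  · intro r θ hr hθ
    change ((0 < r * cos θ ∧ 0 < r * sin θ ∧ (r * cos θ) ^ 2 + (r * sin θ) ^ 2 < 1) ∧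
      8 * (r * cos θ * (r * sin θ)) < c * π * ((r * cos θ) ^ 2 + (r * sin θ) ^ 2)) ↔
        r < 1 ∧ (0 < θ ∧ θ < π / 2) ∧ 4 * sin (2 * θ) < c * π
    rw [polar_sq_add_sq, polar_eight_mul, mul_comm _ (r ^ 2), mul_lt_mul_iff_right₀ (by positivity),
      mul_pos_iff_of_pos_left hr, mul_pos_iff_of_pos_left hr, sq_lt_one_iff₀ hr.le]
    have hangle : 0 < cos θ ∧ 0 < sin θ ↔ 0 < θ ∧ θ < π / 2 := by
      constructor
      · rintro ⟨h1, h2⟩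
        constructor
        · by_contra! h
          linarith [sin_nonpos_of_nonpos_of_neg_pi_le h hθ.1.le]
        · by_contra! h
          linarith [cos_nonpos_of_pi_div_two_le_of_le h (by linarith [hθ.2, pi_pos])]
      · rintro ⟨h1, h2⟩
        exact ⟨cos_pos_of_mem_Ioo ⟨by linarith, h2⟩, sin_pos_of_pos_of_lt_pi h1 hθ.2⟩
    rw [← hangle]
    tauto

theorem tendsto_ncard_disc :
    Tendsto (fun R : ℝ => ({k : Fin 2 → ℤ | (R⁻¹ * k 0, R⁻¹ * k 1) ∈ disc}.ncard : ℝ) / R ^ 2) atTop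
      (𝓝 π) := by
  rw [← volume_disc]
  refine tendsto_ncard_lattice_div isBounded_disc isOpen_disc.measurableSet
    (convex_disc.addHaar_frontier volume) fun p hp x hx hx1 => ?_
  have hp : p.1 ^ 2 + p.2 ^ 2 < 1 := hp
  change (x * p.1) ^ 2 + (x * p.2) ^ 2 < 1
  have : x ^ 2 ≤ 1 := pow_le_one₀ hx.le hx1
  nlinarith [sq_nonneg p.1, sq_nonneg p.2]

theorem tendsto_ncard_sector {c : ℝ} (hc : 0 ≤ c) :
    Tendsto (fun R : ℝ => ({k : Fin 2 → ℤ | (R⁻¹ * k 0, R⁻¹ * k 1) ∈ sector c}.ncard : ℝ) / R ^ 2)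
      atTop (𝓝 (arcsin (π * c / 4) / 2)) := by
  rw [← volume_sector hc]
  refine tendsto_ncard_lattice_div (isBounded_disc.subset fun p hp => hp.1.2.2)
    (isOpen_sector c).measurableSet (volume_frontier_sector c) ?_
  rintro p ⟨⟨h1, h2, h3⟩, h4⟩ x hx hx1
  have h4 : 8 * (p.1 * p.2) < c * π * (p.1 ^ 2 + p.2 ^ 2) := h4
  refine ⟨⟨mul_pos hx h1, mul_pos hx h2, ?_⟩, ?_⟩
  · change (x * p.1) ^ 2 + (x * p.2) ^ 2 < 1
    have : x ^ 2 ≤ 1 := pow_le_one₀ hx.le hx1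
    nlinarith [sq_nonneg p.1, sq_nonneg p.2]
  · change 8 * (x * p.1 * (x * p.2)) < c * π * ((x * p.1) ^ 2 + (x * p.2) ^ 2)
    nlinarith [mul_lt_mul_of_pos_left h4 (pow_pos hx 2)]

end NeumannTorus

/-! ### Weyl law and the limit distribution -/

namespace NeumannTorus

open Real Filter Set
open scoped Topology

/-! ### The Weyl law and the distribution of the Neumann counts -/

theorem tendsto_sqrt_div_two_pi : Tendsto (fun E : ℝ => √E / (2 * π)) atTop atTop :=
  tendsto_sqrt_atTop.atTop_div_const (by positivity)

/-- Energies below E correspond to the disc of radius R = √E/(2π). -/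
theorem scaled_sq_add_sq_lt_one_iff {E : ℝ} (hE : 0 < E) (a b : ℝ) :
    ((√E / (2 * π))⁻¹ * a) ^ 2 + ((√E / (2 * π))⁻¹ * b) ^ 2 < 1 ↔
      4 * π ^ 2 * (a ^ 2 + b ^ 2) < E := by
  have h : ((√E / (2 * π))⁻¹ * a) ^ 2 + ((√E / (2 * π))⁻¹ * b) ^ 2 =
      4 * π ^ 2 * (a ^ 2 + b ^ 2) / E := by
    rw [inv_div, mul_pow, mul_pow, div_pow, sq_sqrt hE.le]; ring
  rw [h, div_lt_one hE]

theorem tendsto_div_of_tendsto_div_sq {f : ℝ → ℝ} {a : ℝ}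
    (h : Tendsto (fun R => f R / R ^ 2) atTop (𝓝 a)) :
    Tendsto (fun E => f (√E / (2 * π)) / E) atTop (𝓝 (a / (4 * π ^ 2))) := by
  refine ((h.comp tendsto_sqrt_div_two_pi).div_const (4 * π ^ 2)).congr' ?_
  filter_upwards [eventually_gt_atTop 0] with E hE
  simp only [Function.comp_apply]
  rw [div_pow, sq_sqrt hE.le]
  field_simp
  ring

/-- The Weyl law of the flat torus. -/
theorem tendsto_spectralPosition_div :
    Tendsto (fun E => (spectralPosition E : ℝ) / E) atTop (𝓝 (1 / (4 * π))) := by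
  have h := tendsto_div_of_tendsto_div_sq tendsto_ncard_disc
  rw [show π / (4 * π ^ 2) = 1 / (4 * π) by field_simp] at h
  refine h.congr' ?_
  filter_upwards [eventually_gt_atTop 0] with E hE
  rw [spectralPosition_eq]
  congr 3
  ext k
  exact scaled_sq_add_sq_lt_one_iff hE _ _

/-- The frequencies of energy less than `E` in the sector of parameter `c`. -/
def sectorPairs (c E : ℝ) : Set (ℕ × ℕ) :=
  {k | 0 < k.1 ∧ 0 < k.2 ∧ eigenvalue k.1 k.2 < E ∧
    8 * (k.1 * k.2 : ℝ) < c * π * ((k.1 : ℝ) ^ 2 + (k.2 : ℝ) ^ 2)}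

/-- The frequencies of energy less than `E` with normalized Neumann count less than `c`. -/
def countPairs (c E : ℝ) : Set (ℕ × ℕ) :=
  {k | 0 < k.1 ∧ 0 < k.2 ∧ eigenvalue k.1 k.2 < E ∧
    (neumannCount (separable k.1 k.2) : ℝ) / (spectralPosition (eigenvalue k.1 k.2) : ℝ) < c}

theorem ncard_sectorPairs {c E : ℝ} (hE : 0 < E) : (sectorPairs c E).ncard =
    {k : Fin 2 → ℤ | ((√E / (2 * π))⁻¹ * k 0, (√E / (2 * π))⁻¹ * k 1) ∈ sector c}.ncard := by
  have hR : 0 < (√E / (2 * π))⁻¹ := by positivity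
  rw [← ncard_image_of_injective (f := fun k : ℕ × ℕ => ![(k.1 : ℤ), (k.2 : ℤ)])]
  · congr 1
    ext k
    have hmem : ∀ a b : ℝ, ((√E / (2 * π))⁻¹ * a, (√E / (2 * π))⁻¹ * b) ∈ sector c ↔
        0 < a ∧ 0 < b ∧ 4 * π ^ 2 * (a ^ 2 + b ^ 2) < E ∧ 8 * (a * b) < c * π * (a ^ 2 + b ^ 2) := by
      intro a b
      rw [← scaled_sq_add_sq_lt_one_iff hE]
      set R := (√E / (2 * π))⁻¹
      change ((0 < R * a ∧ 0 < R * b ∧ (R * a) ^ 2 + (R * b) ^ 2 < 1) ∧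
        8 * (R * a * (R * b)) < c * π * ((R * a) ^ 2 + (R * b) ^ 2)) ↔ _
      rw [mul_pos_iff_of_pos_left hR, mul_pos_iff_of_pos_left hR,
        show 8 * (R * a * (R * b)) = R ^ 2 * (8 * (a * b)) by ring,
        show c * π * ((R * a) ^ 2 + (R * b) ^ 2) = R ^ 2 * (c * π * (a ^ 2 + b ^ 2)) by ring,
        mul_lt_mul_iff_right₀ (pow_pos hR 2)]
      tauto
    simp only [mem_image, mem_ofPred_eq, hmem]
    constructor
    · rintro ⟨⟨a, b⟩, ⟨h1, h2, h3, h4⟩, rfl⟩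
      simp only [eigenvalue] at h3
      simpa using ⟨h1, h2, h3, h4⟩
    · rintro ⟨h1, h2, h3, h4⟩
      obtain ⟨a, ha⟩ := Int.eq_ofNat_of_zero_le (Int.cast_pos.1 h1).le
      obtain ⟨b, hb⟩ := Int.eq_ofNat_of_zero_le (Int.cast_pos.1 h2).le
      refine ⟨(a, b), ?_, ?_⟩
      · rw [ha, hb] at h3 h4
        rw [ha] at h1
        rw [hb] at h2
        exact ⟨by exact_mod_cast h1, by exact_mod_cast h2,
          by simp only [eigenvalue]; exact_mod_cast h3,
          by exact_mod_cast h4⟩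
      · funext i
        fin_cases i
        · exact ha.symm
        · exact hb.symm
  · rintro ⟨a, b⟩ ⟨a', b'⟩ h
    have h0 := congrFun h 0
    have h1 := congrFun h 1
    simpa using And.intro h0 h1

theorem tendsto_sectorPairs_div {c : ℝ} (hc : 0 ≤ c) :
    Tendsto (fun E => ((sectorPairs c E).ncard : ℝ) / E) atTop
      (𝓝 (arcsin (π * c / 4) / 2 / (4 * π ^ 2))) := by
  refine (tendsto_div_of_tendsto_div_sq (tendsto_ncard_sector hc)).congr' ?_
  filter_upwards [eventually_gt_atTop 0] with E hE
  rw [ncard_sectorPairs hE]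

theorem finite_eigenvalue_lt (E : ℝ) :
    {k : ℕ × ℕ | eigenvalue k.1 k.2 < E}.Finite := by
  refine Set.Finite.of_finite_image (f := fun k : ℕ × ℕ => ![(k.1 : ℤ), (k.2 : ℤ)])
    ((finite_latticeEigenvalue_lt E).subset ?_) ?_
  · rintro _ ⟨k, hk, rfl⟩
    simpa [latticeEigenvalue, eigenvalue] using hk
  · rintro ⟨a, b⟩ - ⟨a', b'⟩ - h
    have h0 := congrFun h 0
    have h1 := congrFun h 1
    simpa using And.intro h0 h1

/-- The constant C accounts for the finitely many frequencies at which the sector condition and the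
true condition may disagree; it disappears after division by E. -/
theorem tendsto_cdf_of_ncard {f : ℝ → ℝ} {c C : ℝ} (hc : 0 ≤ c)
    (hf : ∀ E, f E = (sectorPairs c E).ncard + C) :
    Tendsto (fun E => 4 / (spectralPosition E : ℝ) * f E) atTop
      (𝓝 (2 / π * arcsin (π * c / 4))) := by
  have h1 : Tendsto (fun E => f E / E) atTop (𝓝 (arcsin (π * c / 4) / 2 / (4 * π ^ 2))) := by
    have := (tendsto_sectorPairs_div hc).add (tendsto_const_nhds.div_atTop tendsto_id (a := C))
    rw [add_zero] at this
    refine this.congr fun E => ?_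
    rw [hf, add_div]; rfl
  have h2 := (h1.div tendsto_spectralPosition_div (by positivity)).const_mul 4
  have e : 4 * (arcsin (π * c / 4) / 2 / (4 * π ^ 2) / (1 / (4 * π))) =
      2 / π * arcsin (π * c / 4) := by
    field_simp
    ring
  rw [e] at h2
  refine h2.congr' ?_
  filter_upwards [eventually_gt_atTop 0] with E hE
  simp only [Pi.div_apply]
  rw [div_div_div_cancel_right₀ hE.ne']
  ring

theorem eventually_spectralPosition_pos :
    ∀ᶠ E in atTop, (0 : ℝ) < spectralPosition E := by
  filter_upwards [tendsto_spectralPosition_div.eventually (lt_mem_nhds (by positivity)),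
    eventually_gt_atTop 0] with E h1 h2
  rwa [div_pos_iff_of_pos_right h2] at h1

theorem tendsto_mul_spectralPosition (c : ℝ) :
    Tendsto (fun E => c * ((spectralPosition E : ℝ) / E * (4 * π))) atTop (𝓝 c) := by
  have := (tendsto_spectralPosition_div.mul_const (4 * π)).const_mul c
  rwa [one_div_mul_cancel (by positivity), mul_one] at this

theorem mul_spectralPosition_div_eigenvalue {m n : ℕ} (hm : 0 < m) (c N : ℝ) :
    c * (N / eigenvalue m n * (4 * π)) = c * N / (π * ((m : ℝ) ^ 2 + (n : ℝ) ^ 2)) := by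
  unfold eigenvalue
  field_simp

/-- At an eigenvalue λ beyond E₀ the Weyl law gives c·N(λ) < c'·π(m² + n²), so 8mn < c·N(λ) implies
the sector condition for c'. -/
theorem exists_countPairs_subset {c c' : ℝ} (hc : c < c') : ∃ E₀, ∀ E,
    countPairs c E ⊆ sectorPairs c' E ∪ {k | eigenvalue k.1 k.2 < E₀} := by
  obtain ⟨E₀, h⟩ := eventually_atTop.1 (((tendsto_mul_spectralPosition c).eventually
    (gt_mem_nhds hc)).and eventually_spectralPosition_pos)
  refine ⟨E₀, fun E k ⟨h1, h2, h3, h4⟩ => or_iff_not_imp_right.2 fun h5 => ?_⟩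
  obtain ⟨h6, h7⟩ := h _ (not_lt.1 h5)
  have hq : 0 < π * ((k.1 : ℝ) ^ 2 + (k.2 : ℝ) ^ 2) := by positivity
  rw [mul_spectralPosition_div_eigenvalue h1, div_lt_iff₀ hq] at h6
  rw [neumannCount_separable h1 h2, div_lt_iff₀ h7] at h4
  push_cast at h4
  exact ⟨h1, h2, h3, by linarith⟩

theorem exists_sectorPairs_subset {c c' : ℝ} (hc : c' < c) : ∃ E₀, ∀ E,
    sectorPairs c' E ⊆ countPairs c E ∪ {k | eigenvalue k.1 k.2 < E₀} := by
  obtain ⟨E₀, h⟩ := eventually_atTop.1 (((tendsto_mul_spectralPosition c).eventually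
    (lt_mem_nhds hc)).and eventually_spectralPosition_pos)
  refine ⟨E₀, fun E k ⟨h1, h2, h3, h4⟩ => or_iff_not_imp_right.2 fun h5 => ?_⟩
  obtain ⟨h6, h7⟩ := h _ (not_lt.1 h5)
  have hq : 0 < π * ((k.1 : ℝ) ^ 2 + (k.2 : ℝ) ^ 2) := by positivity
  rw [mul_spectralPosition_div_eigenvalue h1, lt_div_iff₀ hq] at h6
  refine ⟨h1, h2, h3, ?_⟩
  rw [neumannCount_separable h1 h2, div_lt_iff₀ h7]
  push_cast
  linarith

theorem cdf_eq (E c : ℝ) :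
    cdf E c = 4 / (spectralPosition E : ℝ) * ((countPairs c E).ncard : ℝ) := rfl

/-- The distribution is squeezed between sector counts with parameters on either side of c, chosen
by continuity of the limit function. -/
theorem tendsto_cdf {c : ℝ} (hc : 0 ≤ c) :
    Tendsto (fun E => cdf E c) atTop (𝓝 (2 / π * arcsin (π * c / 4))) := by
  have hG : Continuous fun c : ℝ => 2 / π * arcsin (π * c / 4) := by fun_prop
  have hsec : ∀ c E, (sectorPairs c E).Finite := fun c E =>
    (finite_eigenvalue_lt E).subset fun k hk => hk.2.2.1
  have hcnt : ∀ c E, (countPairs c E).Finite := fun c E =>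
    (finite_eigenvalue_lt E).subset fun k hk => hk.2.2.1
  refine tendsto_order.2 ⟨fun a ha => ?_, fun a ha => ?_⟩
  -- At c = 0 there is no smaller nonnegative parameter, but the limit is 0 and the distribution is
  -- nonnegative.
  · rcases hc.eq_or_lt with rfl | hc
    · refine .of_forall fun E => ha.trans_le ?_
      rw [mul_zero, zero_div, arcsin_zero, mul_zero, cdf_eq]
      positivity
    · obtain ⟨c', h1, h2⟩ := (((hG.tendsto c).eventually (lt_mem_nhds ha)).filter_mono
        nhdsWithin_le_nhds |>.and (Ioo_mem_nhdsLT hc)).exists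
      obtain ⟨E₀, h3⟩ := exists_sectorPairs_subset h2.2
      have hZ := finite_eigenvalue_lt E₀
      filter_upwards [(tendsto_cdf_of_ncard (C := -({k : ℕ × ℕ | eigenvalue k.1 k.2 < E₀}.ncard : ℝ))
        h2.1.le fun E => rfl).eventually (lt_mem_nhds h1)] with E hE
      refine hE.trans_le ?_
      rw [cdf_eq]
      gcongr
      have := (ncard_le_ncard (h3 E) ((hcnt _ _).union hZ)).trans (ncard_union_le _ _)
      have : ((sectorPairs c' E).ncard : ℝ) ≤
        (countPairs c E).ncard + {k : ℕ × ℕ | eigenvalue k.1 k.2 < E₀}.ncard := by exact_mod_cast this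
      linarith
  · obtain ⟨c', h1, h2⟩ := (((hG.tendsto c).eventually (gt_mem_nhds ha)).filter_mono
      nhdsWithin_le_nhds |>.and (self_mem_nhdsWithin (s := Ioi c))).exists
    obtain ⟨E₀, h3⟩ := exists_countPairs_subset h2
    have hZ := finite_eigenvalue_lt E₀
    filter_upwards [(tendsto_cdf_of_ncard (C := ({k : ℕ × ℕ | eigenvalue k.1 k.2 < E₀}.ncard : ℝ))
      (hc.trans (le_of_lt h2)) fun E => rfl).eventually (gt_mem_nhds h1)] with E hE
    refine lt_of_le_of_lt ?_ hE
    rw [cdf_eq]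
    gcongr
    exact_mod_cast (ncard_le_ncard (h3 E) ((hsec _ _).union hZ)).trans (ncard_union_le _ _)

/-- The antiderivative is (4/π) arcsin(πx/4); c < 4/π keeps the integrand continuous on [0, c]. -/
theorem arcsin_eq_integral {c : ℝ} (hc0 : 0 ≤ c) (hc : c < 4 / π) :
    2 / π * arcsin (π * c / 4) =
      1 / 2 * ∫ x in (0 : ℝ)..c, 1 / √(1 - (π / 4 * x) ^ 2) := by
  have hlt : ∀ x ∈ uIcc 0 c, 0 ≤ π / 4 * x ∧ π / 4 * x < 1 := by
    intro x hx
    rw [uIcc_of_le hc0] at hx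
    refine ⟨mul_nonneg (by positivity) hx.1, ?_⟩
    have := mul_lt_mul_of_pos_left (hx.2.trans_lt hc) (show 0 < π / 4 by positivity)
    rwa [div_mul_div_cancel₀' (by norm_num), div_self four_ne_zero] at this
  have hint := intervalIntegral.integral_eq_sub_of_hasDerivAt
    (f := fun x => 4 / π * arcsin (π / 4 * x)) (f' := fun x => 1 / √(1 - (π / 4 * x) ^ 2))
    (a := 0) (b := c) (fun x hx => ?_) ?_
  · rw [hint, mul_zero, arcsin_zero, show π * c / 4 = π / 4 * c by ring]
    ring
  · obtain ⟨h0, h1⟩ := hlt x hx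
    have hd := (((hasDerivAt_arcsin (by linarith) h1.ne).comp x
      ((hasDerivAt_id x).const_mul (π / 4))).const_mul (4 / π))
    convert! hd using 1
    field_simp
  · refine ContinuousOn.intervalIntegrable (continuousOn_const.div (by fun_prop) fun x hx => ?_)
    obtain ⟨h0, h1⟩ := hlt x hx
    refine (sqrt_pos.2 ?_).ne'
    nlinarith

end NeumannTorus

theorem mainTheorem2 :
    (∀ c : ℝ, 0 ≤ c → c < 4 / Real.pi →
      Filter.Tendsto (fun E : ℝ => NeumannTorus.cdf E c) Filter.atTop
          (nhds (2 / Real.pi * Real.arcsin (Real.pi * c / 4))) ∧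
      2 / Real.pi * Real.arcsin (Real.pi * c / 4) =
          1 / 2 * ∫ x in (0 : ℝ)..c, 1 / Real.sqrt (1 - (Real.pi / 4 * x) ^ 2)) ∧
    (∀ c : ℝ, 4 / Real.pi ≤ c →
      Filter.Tendsto (fun E : ℝ => NeumannTorus.cdf E c) Filter.atTop (nhds 1)) := by
  refine ⟨fun c h0 h1 => ⟨NeumannTorus.tendsto_cdf h0, NeumannTorus.arcsin_eq_integral h0 h1⟩,
    fun c hc => ?_⟩
  have hpi := Real.pi_pos
  have h0 : 0 ≤ c := le_trans (by positivity) hc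
  have h1 : 1 ≤ Real.pi * c / 4 := by
    rw [div_le_iff₀ hpi] at hc
    linarith
  have h := NeumannTorus.tendsto_cdf h0
  rwa [Real.arcsin_of_one_le h1, div_mul_div_cancel₀' two_ne_zero, div_self hpi.ne'] at h
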